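/- Let $(\Sigma,I)$ be an independence pair: $\Sigma$ is a finite alphabet and $I$ an irreflexive symmetric relation on $\Sigma$; letters $\alpha,\beta$ are parallel if $(\alpha,\beta)\in I$ and dependent otherwise. Let $\mathcal M=\langle\Sigma\mid\alpha\cdot\beta=\beta\cdot\alpha\text{ for }(\alpha,\beta)\in I\rangle$ be the trace monoid, with unit $0$, length $|\cdot|$ and left divisibility order $\le$, and assume that $\mathcal M$ is irreducible, i.e. that the dependence graph on $\Sigma$ is connected. A clique is a product of pairwise parallel distinct letters, identified with the set of these letters; $\mathscr C$ is the set of cliques and $\mathfrak C=\mathscr C\setminus\{0\}$ the set of non-empty cliques. For cliques $c,c'$ write $c\to c'$ if every letter of $c'$ is dependent on some letter of $c$. Generalized traces are the classes of non-decreasing sequences in $(\mathcal M,\le)$ under the equivalence associated with the preorder $(u_k)\preccurlyeq(v_k)\iff\forall k\,\exists k'\ u_k\le v_{k'}$, ordered by $\preccurlyeq$; $\mathcal M$ embeds through constant sequences. The boundary $\partial\mathcal M$ is the set of generalized traces not in $\mathcal M$, with the $\sigma$-algebra generated by the cylinders $\uparrow u=\{\xi\in\partial\mathcal M: u\le\xi\}$,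 $u\in\mathcal M$. Let $\Omega$ be the space of infinite sequences $(c_k)_{k\ge1}$ in $\mathfrak C$ with $c_k\to c_{k+1}$ for all $k\ge 1$, with the $\sigma$-algebra induced by the product $\sigma$-algebra. There is a bi-measurable bijection $\Psi:\partial\mathcal M\to\Omega$, $\xi\mapsto(C_k(\xi))_{k\ge1}$, such that $\bigvee_{k\ge1}(C_1(\xi)\cdots C_k(\xi))=\xi$ for every $\xi\in\partial\mathcal M$. A valuation is a function $f:\mathcal M\to(0,\infty)$ with $f(u\cdot v)=f(u)f(v)$ for all $u,v$; its Möbius transform is $h:\mathscr C\to\mathbb R$, $h(c)=\sum_{c'\in\mathscr C,\ c\le c'}(-1)^{|c'|-|c|}f(c')$; $f$ is a Möbius valuation if $h(0)=0$ and $h(c)>0$ for all $c\in\mathfrak C$. A Bernoulli measure is a probability measure $\mathbb P$ on $\partial\mathcal M$ with $\mathbb P(\uparrow u)>0$ and $\mathbb P(\uparrow(u\cdot v))=\mathbb P(\uparrow u)\,\mathbb P(\uparrow v)$ for all $u,v\in\mathcal M$. For a function $h:\mathscr C\to\mathbb R$, let $P=(P_{c,c'})_{c,c'\in\mathfrak C}$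 be given by $$P_{c,c'}=\begin{cases}h(c')/g(c)&\text{if }c\to c',\\0&\text{otherwise,}\end{cases}\qquad g(c)=\sum_{c'\in\mathfrak C,\ c\to c'}h(c').\tag{$*$}$$ 1. Let $\mathbb P$ be a Bernoulli measure on $\partial\mathcal M$, let $f(u)=\mathbb P(\uparrow u)$ be the induced valuation and $h$ its Möbius transform. Then, under $\mathbb P$, the sequence $(C_k)_{k\ge1}$ is an irreducible and aperiodic Markov chain with values in $\mathfrak C$; the law of $C_1$ is the restriction of $h$ to $\mathfrak C$, one has $h>0$ on $\mathfrak C$, and the transition matrix is $P$ given by $(*)$. Furthermore, for every $n\ge1$ and all non-empty cliques with $c_1\to\cdots\to c_n$, $$\mathbb P(C_1=c_1,\dots,C_n=c_n)=f(c_1)\cdots f(c_{n-1})\,h(c_n).$$ 2. Conversely, let $f$ be a Möbius valuation with Möbius transform $h$. Then the restriction of $h$ to $\mathfrak C$ is a probability distribution on $\mathfrak C$. The Markov chain on $\mathfrak C$ with initial law $h|_{\mathfrak C}$ and transition matrix $P$ given by $(*)$ has a (unique) law on $\Omega$, whose image $\mathbb P$ under $\Psi^{-1}$ is a Bernoulli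 measure on $\partial\mathcal M$ satisfying $\mathbb P(\uparrow u)=f(u)$ for all $u\in\mathcal M$. -/

import Mathlib

open MeasureTheory ProbabilityTheory

noncomputable section

/-! Throughout, an independence pair is a type `A` of letters together with a simple graph `I` on
`A`: `I.Adj a b` says that the letters `a` and `b` are parallel. Two letters are dependent when
`¬ I.Adj a b`, so that the dependence graph (without its self-loops) is `Iᶜ`. -/

namespace Trace

variable {A : Type*}

/-! ### The trace monoid -/

/-- The defining relations `a b = b a`, for parallel letters `a` and `b`. -/
def rels (I : SimpleGraph A) (v w : FreeMonoid A) : Prop :=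
  ∃ a b, I.Adj a b ∧ v = FreeMonoid.of a * FreeMonoid.of b ∧ w = FreeMonoid.of b * FreeMonoid.of a

/-- The trace monoid `⟨A | a b = b a for all parallel a, b⟩`. -/
def TraceMonoid (I : SimpleGraph A) : Type _ := PresentedMonoid (rels I)

instance (I : SimpleGraph A) : Monoid (TraceMonoid I) :=
  inferInstanceAs (Monoid (PresentedMonoid (rels I)))

/-- The trace consisting of one letter. -/
def letter (I : SimpleGraph A) (a : A) : TraceMonoid I := PresentedMonoid.of (rels I) a

lemma letter_commute (I : SimpleGraph A) {a b : A} (h : I.Adj a b) :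
    Commute (letter I a) (letter I b) :=
  Quotient.sound (ConGen.Rel.of _ _ ⟨a, b, h, rfl, rfl⟩)

/-- The length as a monoid homomorphism to `Multiplicative ℕ`. -/
def lengthHom (I : SimpleGraph A) : TraceMonoid I →* Multiplicative ℕ :=
  PresentedMonoid.lift (rels := rels I) (fun _ => Multiplicative.ofAdd 1) (by
    rintro _ _ ⟨a, b, -, rfl, rfl⟩
    rfl)

/-- The length `|u|` of a trace: the number of letters of any representative word. -/
def length {I : SimpleGraph A} (u : TraceMonoid I) : ℕ := (lengthHom I u).toAdd

lemma length_mul {I : SimpleGraph A} (u v : TraceMonoid I) :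
    length (u * v) = length u + length v := by
  simp [length]

lemma length_letter {I : SimpleGraph A} (a : A) : length (letter I a) = 1 := by
  simp only [length, lengthHom, letter]
  rfl

lemma eq_one_of_length {I : SimpleGraph A} (u : TraceMonoid I) (hu : length u = 0) : u = 1 := by
  obtain ⟨w, rfl⟩ := PresentedMonoid.surjective_mk (rels := rels I) u
  induction w using FreeMonoid.casesOn with
  | one => exact map_one _
  | of_mul a w =>
    rw [map_mul] at hu
    have h := length_mul (I := I) (letter I a) (PresentedMonoid.mk (rels I) w)
    rw [length_letter] at h
    exact absurd (h.symm.trans hu) (by omega)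

/-- Left divisibility: `u ≤ v` if and only if `v = u * w` for some trace `w`. -/
instance (I : SimpleGraph A) : PartialOrder (TraceMonoid I) where
  le u v := ∃ w, v = u * w
  le_refl u := ⟨1, (mul_one u).symm⟩
  le_trans := by
    rintro u _ _ ⟨w, rfl⟩ ⟨w', rfl⟩
    exact ⟨w * w', mul_assoc _ _ _⟩
  le_antisymm := by
    rintro u _ ⟨w, rfl⟩ ⟨w', h⟩
    have h1 := congrArg length h
    rw [length_mul, length_mul] at h1
    rw [eq_one_of_length w (by omega), mul_one]

/-! ### Cliques -/

/-- A clique: a finite set of pairwise parallel letters, identified with the product of its letters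
(see `Clique.trace`). The empty clique is the unit of the monoid. -/
def Clique (I : SimpleGraph A) : Type _ := {c : Finset A // I.IsClique (c : Set A)}

/-- The trace of a clique: the product of its letters, in any order. -/
def Clique.trace {I : SimpleGraph A} (c : Clique I) : TraceMonoid I :=
  c.1.noncommProd (letter I) (fun _ ha _ hb hab => letter_commute I (c.2 ha hb hab))

/-- The empty clique. -/
def Clique.empty (I : SimpleGraph A) : Clique I := ⟨∅, by simp⟩

/-- The non-empty cliques. -/
def NECliq (I : SimpleGraph A) : Type _ := {c : Clique I // c.1.Nonempty}

/-- The trace of a non-empty clique. -/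
def NECliq.trace {I : SimpleGraph A} (c : NECliq I) : TraceMonoid I := c.1.trace

instance (I : SimpleGraph A) [Finite A] : Finite (Clique I) :=
  inferInstanceAs (Finite {c : Finset A // I.IsClique (c : Set A)})

instance (I : SimpleGraph A) [Finite A] : Finite (NECliq I) :=
  inferInstanceAs (Finite {c : Clique I // c.1.Nonempty})

instance (I : SimpleGraph A) [Finite A] : Fintype (Clique I) := Fintype.ofFinite _

instance (I : SimpleGraph A) [Finite A] : Fintype (NECliq I) := Fintype.ofFinite _

instance (I : SimpleGraph A) : DecidableEq (NECliq I) := Classical.decEq _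

/-- The discrete σ-algebra on the set of non-empty cliques. -/
instance (I : SimpleGraph A) : MeasurableSpace (NECliq I) := ⊤

/-- Cartier–Foata admissibility `c → c'`: every letter of `c'` depends on some letter of `c`. -/
def Admissible {I : SimpleGraph A} (c c' : Clique I) : Prop :=
  ∀ b ∈ c'.1, ∃ a ∈ c.1, ¬ I.Adj a b

/-! ### Generalized traces and the boundary -/

/-- Non-decreasing sequences of traces. -/
def NDSeq (I : SimpleGraph A) : Type _ :=
  {u : ℕ → TraceMonoid I // ∀ k, u k ≤ u (k + 1)}

/-- The Egli–Milner preorder on non-decreasing sequences. -/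
instance (I : SimpleGraph A) : Preorder (NDSeq I) where
  le u v := ∀ k, ∃ k', u.1 k ≤ v.1 k'
  le_refl u k := ⟨k, le_rfl⟩
  le_trans u v w huv hvw k := by
    obtain ⟨k', h⟩ := huv k
    obtain ⟨k'', h'⟩ := hvw k'
    exact ⟨k'', h.trans h'⟩

/-- Generalized traces: the partial order obtained by collapsing the Egli–Milner preorder. -/
abbrev GenTrace (I : SimpleGraph A) : Type _ := Antisymmetrization (NDSeq I) (· ≤ ·)

/-- The embedding of traces into generalized traces, through constant sequences. -/
def embed {I : SimpleGraph A} (u : TraceMonoid I) : GenTrace I :=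
  toAntisymmetrization (· ≤ ·) (⟨fun _ => u, fun _ => le_rfl⟩ : NDSeq I)

/-- The boundary: the set of infinite traces, i.e. of generalized traces that are not traces. -/
def Boundary (I : SimpleGraph A) : Type _ := {ξ : GenTrace I // ξ ∉ Set.range (embed (I := I))}

/-- The elementary cylinder `↑u` of base `u`. -/
def cyl {I : SimpleGraph A} (u : TraceMonoid I) : Set (Boundary I) := {ξ | embed u ≤ ξ.1}

/-- The σ-algebra on the boundary generated by the elementary cylinders. -/
instance (I : SimpleGraph A) : MeasurableSpace (Boundary I) :=
  MeasurableSpace.generateFrom (Set.range (cyl (I := I)))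

/-! ### The Cartier–Foata subshift -/

/-- Infinite paths `c₁ → c₂ → ⋯` of non-empty cliques; the clique `c_{k+1}` has index `k`. -/
def Path (I : SimpleGraph A) : Type _ :=
  {ω : ℕ → NECliq I // ∀ k, Admissible (ω k).1 (ω (k + 1)).1}

/-- The σ-algebra on paths induced by the product σ-algebra. -/
instance (I : SimpleGraph A) : MeasurableSpace (Path I) :=
  inferInstanceAs
    (MeasurableSpace {ω : ℕ → NECliq I // ∀ k, Admissible (ω k).1 (ω (k + 1)).1})

/-- The coordinate maps of the subshift. -/
def coord {I : SimpleGraph A} (k : ℕ) (ω : Path I) : NECliq I := ω.1 k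

/-- The trace `c₁ ⋯ c_{k+1}` formed by the first `k + 1` cliques of a path. -/
def Path.partialProd {I : SimpleGraph A} (ω : Path I) (k : ℕ) : TraceMonoid I :=
  ((List.range (k + 1)).map (fun i => (ω.1 i).trace)).prod

/-! ### Valuations, Möbius transforms, Bernoulli measures -/

/-- Valuations: positive multiplicative functions on the monoid. -/
def IsValuation {I : SimpleGraph A} (f : TraceMonoid I → ℝ) : Prop :=
  (∀ u, 0 < f u) ∧ ∀ u v, f (u * v) = f u * f v

open Classical in
/-- The Möbius transform `h c = ∑_{c' ≥ c} (-1)^(|c'| - |c|) f c'`, a function on cliques. -/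
def mobius {I : SimpleGraph A} [Finite A] (f : TraceMonoid I → ℝ) (c : Clique I) : ℝ :=
  ∑ c' : Clique I with c.trace ≤ c'.trace,
    (-1) ^ (length c'.trace - length c.trace) * f c'.trace

/-- Möbius valuations: the Möbius transform vanishes at the empty clique and is positive at all
non-empty cliques. -/
def IsMobiusValuation {I : SimpleGraph A} [Finite A] (f : TraceMonoid I → ℝ) : Prop :=
  IsValuation f ∧ mobius f (Clique.empty I) = 0 ∧ ∀ c : NECliq I, 0 < mobius f c.1

/-- Bernoulli measures on the boundary. -/
def IsBernoulli {I : SimpleGraph A} (μ : Measure (Boundary I)) : Prop :=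
  IsProbabilityMeasure μ ∧ (∀ u : TraceMonoid I, 0 < μ (cyl u)) ∧
    ∀ u v : TraceMonoid I, μ (cyl (u * v)) = μ (cyl u) * μ (cyl v)

/-- The valuation `u ↦ μ (↑u)` induced by a measure on the boundary. -/
def inducedVal {I : SimpleGraph A} (μ : Measure (Boundary I)) (u : TraceMonoid I) : ℝ :=
  μ.real (cyl u)

open Classical in
/-- The normalization `g c = ∑_{c → c'} h c'`, over the non-empty cliques `c'` with `c → c'`. -/
def normalization {I : SimpleGraph A} [Finite A] (h : Clique I → ℝ) (c : NECliq I) : ℝ :=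
  ∑ c' : NECliq I with Admissible c.1 c'.1, h c'.1

open Classical in
/-- The matrix with entries `h c' / g c` if `c → c'`, and `0` otherwise. -/
def transitionMatrix {I : SimpleGraph A} [Finite A] (h : Clique I → ℝ) :
    Matrix (NECliq I) (NECliq I) ℝ :=
  Matrix.of fun c c' => if Admissible c.1 c'.1 then h c'.1 / normalization h c else 0

/-! ### Markov chains on a finite set -/

/-- Under the probability measure `μ`, the sequence `X 0, X 1, …` is a (homogeneous) Markov chain
with initial law `ν` and transition matrix `P`. -/
structure IsMarkovChain {S E : Type*} [MeasurableSpace S] [MeasurableSpace E] [Fintype E]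
    [DecidableEq E] (μ : Measure S) (X : ℕ → S → E) (ν : E → ℝ) (P : Matrix E E ℝ) : Prop where
  isProbabilityMeasure : IsProbabilityMeasure μ
  measurable : ∀ n, Measurable (X n)
  stochastic : P ∈ Matrix.rowStochastic ℝ E
  initial : ∀ x, μ.real {s | X 0 s = x} = ν x
  markov : ∀ (n : ℕ) (x : ℕ → E) (y : E), μ {s | ∀ i ≤ n, X i s = x i} ≠ 0 →
    (μ[|{s | ∀ i ≤ n, X i s = x i}]).real {s | X (n + 1) s = y} = P (x n) y

/-- Aperiodicity: for each state `x`, the greatest common divisor of the return times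
`n ≥ 1` with `(P ^ n) x x > 0` is `1`. -/
def IsAperiodic {E : Type*} [Fintype E] [DecidableEq E] (P : Matrix E E ℝ) : Prop :=
  ∀ (x : E) (d : ℕ), (∀ n : ℕ, 1 ≤ n → 0 < (P ^ n) x x → d ∣ n) → d = 1

end Trace

end

open Trace

/-! Infinite traces are studied through the ideals of traces below them. The basic tool is Levi's
lemma `letter_mul_eq_letter_mul`, which yields left cancellation and describes the letters that
divide a product. Each ideal `D` of the divisibility order has a Cartier–Foata sequence `cfSeq D`:
its first clique is the set of all letters in `D`, and one then passes to the ideal of the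
quotients. The partial products of this sequence lie in `D` and exhaust it (`le_cliqueProd_cfSeq`).
An infinite trace is determined by its ideal, and its cliques are never empty, which gives the
bijection `boundaryEquiv` with the space of paths. Finite traces correspond to principal ideals, so
that one argument covers finite and infinite traces.

Two facts carry the computation of laws. By `cfSeq_eq_iff_hasNext`, the Cartier–Foata sequence of
`D` starts with the admissible sequence `c₀ → ⋯ → cₙ` if and only if `u = c₀ ⋯ cₙ₋₁` lies in `D`
and `cₙ` is the set of the letters extending `u` within `D`. By `sum_indicator_mem`, the indicator
function of this condition is the alternating sum `∑_{d ⊇ cₙ} (-1)^(|d| - |cₙ|) 1_{u d ∈ D}`.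

For a Bernoulli measure, integrating this identity gives the law `f c₀ ⋯ f cₙ₋₁ h cₙ`. The Möbius
transform vanishes at the empty clique since infinite traces have no empty clique, and it is
positive at every non-empty clique `c` because, the dependence graph being connected, some cylinder
consists of infinite traces with first clique `c` only (`exists_cyl_subset`). With the identity
`h c = f c * g c` (`mobius_eq_mul_normalization`), these laws are those of the Markov chain with
matrix `h c' / g c`. The matrix is aperiodic since `c → c` always holds, and irreducible by
`reachable_of_preconnected`.

Conversely, let `f` be a Möbius valuation. The Markov chain exists by the Ionescu-Tulcea theorem,
and the probability of a cylinder `↑u` is the sum of `f c₀ ⋯ f cₙ₋₁ h cₙ` over the admissible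
sequences with `u ≤ c₀ ⋯ cₙ`, where `n` is large. This sum is `f u`: for every trace `w`, the
indicator of `u ≤ w` is the corresponding sum of the indicators of the possible beginnings of the
Cartier–Foata sequence of `w`, hence a linear combination of indicators of `v ≤ w`. As functions of
`w` these are linearly independent, so that the relation remains true when the indicator of `v ≤ w`
is replaced by `f v` (`IsValuation.eq_sum_cliqueProd`). -/

namespace Trace

section TraceMonoid

variable {A : Type*} {I : SimpleGraph A}

/-! ### Levi's lemma and cancellation -/

lemma trace_induction {p : TraceMonoid I → Prop} (one : p 1)
    (letter_mul : ∀ a u, p u → p (letter I a * u)) (u : TraceMonoid I) : p u := by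
  obtain ⟨w, rfl⟩ := PresentedMonoid.surjective_mk (rels := rels I) u
  induction w using FreeMonoid.inductionOn' with
  | one => exact one
  | of_mul a w ih => exact letter_mul a _ ih

open Classical in
/-- The letter `b` acting on pairs `(u, r)`, where `r a` records the quotient of `u` by the letter
`a` on the left, if it exists: the product `b u` is divisible by `b`, and by those divisors of `u`
that are parallel to `b`. -/
noncomputable def letterQuotStep (I : SimpleGraph A) (b : A) :
    Function.End (TraceMonoid I × (A → Option (TraceMonoid I))) := fun x =>
  (letter I b * x.1, fun a => if a = b then some x.1 else
    if I.Adj a b then (x.2 a).map (letter I b * ·) else none)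

open Classical in
lemma letterQuotStep_comm {b c : A} (h : I.Adj b c) :
    letterQuotStep I b * letterQuotStep I c = letterQuotStep I c * letterQuotStep I b := by
  funext x
  have hc := letter_commute I h
  have hne : b ≠ c := h.ne
  refine Prod.ext ?_ ?_
  · change letter I b * (letter I c * x.1) = letter I c * (letter I b * x.1)
    rw [← mul_assoc, hc.eq, mul_assoc]
  · funext a
    change (if a = b then some (letter I c * x.1) else if I.Adj a b then
      (if a = c then some x.1 else if I.Adj a c then (x.2 a).map (letter I c * ·) else none).map
        (letter I b * ·) else none) =
      (if a = c then some (letter I b * x.1) else if I.Adj a c then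
      (if a = b then some x.1 else if I.Adj a b then (x.2 a).map (letter I b * ·) else none).map
        (letter I c * ·) else none)
    by_cases hab : a = b
    · subst hab
      simp [hne, h]
    by_cases hac : a = c
    · subst hac
      simp [hab, h.symm]
    by_cases h1 : I.Adj a b <;> by_cases h2 : I.Adj a c <;> simp [hab, hac, h1, h2]
    rw [hc.eq]

/-- The action of the trace monoid generated by `letterQuotStep`; it is well defined because
parallel letters act by commuting maps. -/
noncomputable def letterQuotHom (I : SimpleGraph A) :
    TraceMonoid I →* Function.End (TraceMonoid I × (A → Option (TraceMonoid I))) :=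
  PresentedMonoid.lift (rels := rels I) (letterQuotStep I) (by
    rintro _ _ ⟨a, b, h, rfl, rfl⟩
    simpa using letterQuotStep_comm h)

/-- The quotient of the trace `u` by the letter `a` on the left, if it exists. -/
noncomputable def letterQuot (u : TraceMonoid I) (a : A) : Option (TraceMonoid I) :=
  (letterQuotHom I u (1, fun _ => none)).2 a

lemma letterQuotHom_letter_mul (a : A) (u : TraceMonoid I) (x) :
    letterQuotHom I (letter I a * u) x = letterQuotStep I a (letterQuotHom I u x) := by
  rw [map_mul]
  rfl

lemma letterQuotHom_fst (u : TraceMonoid I) : (letterQuotHom I u (1, fun _ => none)).1 = u := by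
  induction u using trace_induction with
  | one => rw [map_one]; rfl
  | letter_mul a u ih =>
    rw [letterQuotHom_letter_mul]
    change letter I a * _ = _
    rw [ih]

open Classical in
lemma letterQuot_letter_mul (u : TraceMonoid I) (a b : A) :
    letterQuot (letter I b * u) a = if a = b then some u else
      if I.Adj a b then (letterQuot u a).map (letter I b * ·) else none := by
  rw [letterQuot, letterQuotHom_letter_mul]
  simp only [letterQuotStep, letterQuotHom_fst]
  rfl

lemma eq_of_letterQuot_eq_some {u : TraceMonoid I} : ∀ {a : A} {v : TraceMonoid I},
    letterQuot u a = some v → u = letter I a * v := by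
  induction u using trace_induction with
  | one =>
    intro a v h
    rw [letterQuot, map_one] at h
    exact absurd h (Option.some_ne_none v).symm
  | letter_mul b u ih =>
    intro a v h
    rw [letterQuot_letter_mul] at h
    split_ifs at h with h1 h2
    · rw [h1, Option.some.inj h]
    · obtain ⟨w, hw, rfl⟩ := Option.map_eq_some_iff.1 h
      rw [ih hw, ← mul_assoc, ← (letter_commute I h2).eq, mul_assoc]

/-- Levi's lemma for trace monoids, for factorizations that start with a letter. -/
lemma letter_mul_eq_letter_mul {a b : A} {u v : TraceMonoid I}
    (h : letter I a * u = letter I b * v) :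
    (a = b ∧ u = v) ∨
      (I.Adj a b ∧ ∃ w, u = letter I b * w ∧ v = letter I a * w) := by
  have h1 : letterQuot (letter I a * u) a = some u := by simp [letterQuot_letter_mul]
  rw [h, letterQuot_letter_mul] at h1
  split_ifs at h1 with hab hadj
  · exact .inl ⟨hab, (Option.some.inj h1).symm⟩
  · obtain ⟨w, hw, rfl⟩ := Option.map_eq_some_iff.1 h1
    exact .inr ⟨hadj, w, rfl, eq_of_letterQuot_eq_some hw⟩

lemma trace_mul_left_cancel {u v w : TraceMonoid I} (h : u * v = u * w) : v = w := by
  induction u using trace_induction with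
  | one => simpa using h
  | letter_mul a u ih =>
    rw [mul_assoc, mul_assoc] at h
    rcases letter_mul_eq_letter_mul h with ⟨-, h⟩ | ⟨h, -⟩
    · exact ih h
    · exact absurd h (I.loopless.irrefl _)

/-! ### Left divisibility by letters and cliques -/

lemma le_mul_right (u v : TraceMonoid I) : u ≤ u * v := ⟨v, rfl⟩

lemma mul_le_mul_iff {u v w : TraceMonoid I} : u * v ≤ u * w ↔ v ≤ w := by
  constructor
  · rintro ⟨x, hx⟩
    exact ⟨x, trace_mul_left_cancel (u := u) (by rw [hx, mul_assoc])⟩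
  · rintro ⟨x, rfl⟩
    exact ⟨x, (mul_assoc _ _ _).symm⟩

lemma length_one : length (1 : TraceMonoid I) = 0 := by simp [length]

lemma length_le {u v : TraceMonoid I} (h : u ≤ v) : length u ≤ length v := by
  obtain ⟨w, rfl⟩ := h
  rw [length_mul]; omega

lemma one_le_trace (u : TraceMonoid I) : 1 ≤ u := ⟨u, (one_mul u).symm⟩

lemma not_letter_le_one (a : A) : ¬ letter I a ≤ 1 := fun h => by
  have := length_le h
  rw [length_one, length_letter] at this
  omega

lemma exists_letter_le {u : TraceMonoid I} (hu : u ≠ 1) : ∃ a, letter I a ≤ u := by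
  induction u using trace_induction with
  | one => exact absurd rfl hu
  | letter_mul a u _ => exact ⟨a, le_mul_right _ _⟩

lemma letter_le_letter_mul {a b : A} {u : TraceMonoid I} :
    letter I a ≤ letter I b * u ↔ a = b ∨ (I.Adj a b ∧ letter I a ≤ u) := by
  constructor
  · rintro ⟨w, hw⟩
    rcases letter_mul_eq_letter_mul hw.symm with ⟨h, -⟩ | ⟨h, x, -, hx⟩
    · exact .inl h
    · exact .inr ⟨h, x, hx⟩
  · rintro (rfl | ⟨h, w, rfl⟩)
    · exact le_mul_right _ _
    · exact ⟨letter I b * w, by rw [← mul_assoc, ← (letter_commute I h).eq, mul_assoc]⟩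

/-- A letter dividing `w q` divides `w` or commutes with all letters of the word `w`. -/
lemma letter_le_word_mul {a : A} {w : List A} {q : TraceMonoid I}
    (h : letter I a ≤ (w.map (letter I)).prod * q) :
    letter I a ≤ (w.map (letter I)).prod ∨ ∀ b ∈ w, I.Adj a b := by
  induction w with
  | nil => simp
  | cons b w ih =>
    rw [List.map_cons, List.prod_cons] at h ⊢
    rw [mul_assoc, letter_le_letter_mul] at h
    rcases h with rfl | ⟨h, h'⟩
    · exact .inl (le_mul_right _ _)
    · rcases ih h' with h1 | h1
      · exact .inl (letter_le_letter_mul.2 (.inr ⟨h, h1⟩))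
      · exact .inr (by simpa using ⟨h, h1⟩)

/-- If the letter `a` and the trace `u` divide the same trace on the left, then `a` divides `u` or
commutes with it. -/
lemma letter_le_or_commute {a : A} {u q : TraceMonoid I} (h : letter I a ≤ u * q) :
    letter I a ≤ u ∨ (u * letter I a = letter I a * u ∧ letter I a ≤ q) := by
  induction u using trace_induction with
  | one => exact .inr ⟨by simp, by simpa using h⟩
  | letter_mul b u ih =>
    rw [mul_assoc, letter_le_letter_mul] at h
    rcases h with rfl | ⟨h, h'⟩
    · exact .inl (le_mul_right _ _)
    · rcases ih h' with h1 | ⟨h1, h2⟩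
      · exact .inl (letter_le_letter_mul.2 (.inr ⟨h, h1⟩))
      · refine .inr ⟨?_, h2⟩
        rw [mul_assoc, h1, ← mul_assoc, ← mul_assoc, (letter_commute I h).eq]

lemma Clique.trace_empty : (Clique.empty I).trace = 1 := rfl

lemma Clique.trace_insert [DecidableEq A] {a : A} {c : Clique I} (ha : a ∉ c.1)
    (h : I.IsClique ((insert a c.1 : Finset A) : Set A)) :
    Clique.trace ⟨insert a c.1, h⟩ = letter I a * c.trace := by
  exact Finset.noncommProd_insert_of_notMem c.1 a (letter I) _ ha

lemma Clique.induction [DecidableEq A] {p : Clique I → Prop} (empty : p (Clique.empty I))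
    (insert : ∀ (a : A) (c : Clique I) (h : I.IsClique ((insert a c.1 : Finset A) : Set A)),
      a ∉ c.1 → (∀ b ∈ c.1, I.Adj a b) → p c → p ⟨insert a c.1, h⟩) (c : Clique I) : p c := by
  obtain ⟨s, hs⟩ := c
  induction s using Finset.induction_on with
  | empty => exact empty
  | insert a s ha ih =>
    have hs' : I.IsClique (s : Set A) := hs.subset (by simp)
    refine insert a ⟨s, hs'⟩ hs ha (fun b hb => ?_) (ih hs')
    exact hs (by simp) (by simp [show b ∈ s from hb]) (fun h => ha (h ▸ hb))

lemma Clique.trace_union [DecidableEq A] {c d : Clique I} (hcd : ∀ a ∈ c.1, ∀ b ∈ d.1, I.Adj a b)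
    (h : I.IsClique ((c.1 ∪ d.1 : Finset A) : Set A)) :
    Clique.trace ⟨c.1 ∪ d.1, h⟩ = c.trace * d.trace := by
  exact Finset.noncommProd_union_of_disjoint
    (Finset.disjoint_left.2 fun a ha hb => I.loopless.irrefl _ (hcd a ha a hb)) (letter I) _

lemma Clique.length_trace (c : Clique I) : length c.trace = c.1.card := by
  classical
  induction c using Clique.induction with
  | empty => exact length_one
  | insert a c h ha _ ih =>
    rw [Clique.trace_insert ha, length_mul, ih, length_letter, Finset.card_insert_of_notMem ha]
    omega

lemma letter_le_clique_mul {a : A} {c : Clique I} {q : TraceMonoid I} :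
    letter I a ≤ c.trace * q ↔ a ∈ c.1 ∨ ((∀ b ∈ c.1, I.Adj a b) ∧ letter I a ≤ q) := by
  classical
  induction c using Clique.induction with
  | empty =>
    rw [Clique.trace_empty, one_mul]
    simp [Clique.empty]
  | insert b c h hb hadj ih =>
    rw [Clique.trace_insert hb, mul_assoc, letter_le_letter_mul, ih]
    simp only [Finset.mem_insert, forall_eq_or_imp]
    constructor
    · tauto
    · rintro ((rfl | h1) | h1)
      · exact .inl rfl
      · exact .inr ⟨(hadj a h1).symm, .inl h1⟩
      · tauto

lemma letter_le_clique {a : A} {c : Clique I} : letter I a ≤ c.trace ↔ a ∈ c.1 := by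
  have := letter_le_clique_mul (a := a) (c := c) (q := 1)
  rw [mul_one] at this
  simp [this, not_letter_le_one]

lemma Clique.trace_le {c : Clique I} {u : TraceMonoid I} :
    c.trace ≤ u ↔ ∀ a ∈ c.1, letter I a ≤ u := by
  classical
  refine ⟨fun h a ha => (letter_le_clique.2 ha).trans h, fun h => ?_⟩
  induction c using Clique.induction generalizing u with
  | empty => exact one_le_trace u
  | insert a c hc ha hadj ih =>
    simp only [Finset.mem_insert, forall_eq_or_imp] at h
    obtain ⟨⟨v, rfl⟩, h⟩ := h
    rw [Clique.trace_insert ha, mul_le_mul_iff]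
    refine ih fun b hb => ?_
    rcases letter_le_letter_mul.1 (h b hb) with rfl | h1
    · exact absurd hb ha
    · exact h1.2

lemma Clique.trace_le_trace {c d : Clique I} : c.trace ≤ d.trace ↔ c.1 ⊆ d.1 := by
  rw [Clique.trace_le]
  exact forall₂_congr fun a _ => letter_le_clique

lemma Clique.trace_mul_letter {c : Clique I} {a : A} (h : ∀ b ∈ c.1, I.Adj a b) :
    c.trace * letter I a = letter I a * c.trace := by
  rcases letter_le_or_commute (letter_le_clique_mul (q := letter I a).2 (.inr ⟨h, le_rfl⟩)) with
    h1 | h1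
  · exact absurd (h a (letter_le_clique.1 h1)) (I.loopless.irrefl _)
  · exact h1.1

/-- If `a` and `u` divide `x`, then so does some multiple `a w` of both, with `w` not longer than
`u`, and shorter if `a` divides `u`. -/
lemma exists_letter_mul_between {a : A} {u x : TraceMonoid I} (ha : letter I a ≤ x) (hu : u ≤ x) :
    ∃ w, length w ≤ length u ∧ u ≤ letter I a * w ∧ letter I a * w ≤ x ∧
      (letter I a ≤ u → length w < length u) := by
  obtain ⟨q, rfl⟩ := hu
  by_cases hau : letter I a ≤ u
  · obtain ⟨w, rfl⟩ := hau
    have : length (letter I a * w) = 1 + length w := by rw [length_mul, length_letter]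
    exact ⟨w, by omega, le_rfl, le_mul_right _ _, fun _ => by omega⟩
  · obtain ⟨h1, h2⟩ := (letter_le_or_commute ha).resolve_left hau
    refine ⟨u, le_rfl, ?_, ?_, fun h => absurd h hau⟩
    · rw [← h1]; exact le_mul_right _ _
    · rw [← h1, mul_le_mul_iff]; exact h2

/-- The analogue of `exists_letter_mul_between` for a clique. It bounds the number of cliques needed
to cover a trace `u` by its length. -/
lemma exists_clique_mul_between {c : Clique I} {u x : TraceMonoid I} (hc : c.trace ≤ x)
    (hu : u ≤ x) : ∃ w, length w ≤ length u ∧ u ≤ c.trace * w ∧ c.trace * w ≤ x ∧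
      ((∃ a ∈ c.1, letter I a ≤ u) → length w < length u) := by
  classical
  induction c using Clique.induction generalizing u x with
  | empty => exact ⟨u, le_rfl, by simp [Clique.trace_empty], by simpa [Clique.trace_empty],
      by simp [Clique.empty]⟩
  | insert a c h ha hadj ih =>
    rw [Clique.trace_insert ha] at hc ⊢
    obtain ⟨w, h1, h2, h3, h4⟩ := exists_letter_mul_between ((le_mul_right _ _).trans hc) hu
    obtain ⟨y, rfl⟩ := (le_mul_right (letter I a) w).trans h3
    obtain ⟨w', h1', h2', h3', h4'⟩ := ih (mul_le_mul_iff.1 hc) (mul_le_mul_iff.1 h3)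
    refine ⟨w', h1'.trans h1, ?_, ?_, ?_⟩
    · rw [mul_assoc]; exact h2.trans (mul_le_mul_iff.2 h2')
    · rw [mul_assoc]; exact mul_le_mul_iff.2 h3'
    · rintro ⟨b, hb, hbu⟩
      rcases Finset.mem_insert.1 hb with rfl | hb
      · exact h1'.trans_lt (h4 hbu)
      · have hbc : b ∈ c.1 := hb
        refine (h4' ⟨b, hbc, ?_⟩).trans_le h1
        rcases letter_le_letter_mul.1 (hbu.trans h2) with rfl | h5
        · exact absurd hbc ha
        · exact h5.2

end TraceMonoid

section Ideals

variable {A : Type*} {I : SimpleGraph A}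

/-! ### Ideals of traces and their Cartier–Foata sequences -/

lemma letter_le_or_commute_of_mem {D : Order.Ideal (TraceMonoid I)} {a : A} {u : TraceMonoid I}
    (ha : letter I a ∈ D) (hu : u ∈ D) :
    letter I a ≤ u ∨ (u * letter I a = letter I a * u ∧ u * letter I a ∈ D) := by
  obtain ⟨x, hx, hax, q, rfl⟩ := D.directed _ ha _ hu
  rcases letter_le_or_commute hax with h | ⟨h1, h2⟩
  · exact .inl h
  · exact .inr ⟨h1, D.lower (mul_le_mul_iff.2 h2) hx⟩

lemma Clique.trace_mem {D : Order.Ideal (TraceMonoid I)} {c : Clique I} :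
    c.trace ∈ D ↔ ∀ a ∈ c.1, letter I a ∈ D := by
  classical
  refine ⟨fun h a ha => D.lower (letter_le_clique.2 ha) h, fun h => ?_⟩
  induction c using Clique.induction with
  | empty =>
    obtain ⟨x, hx⟩ := D.nonempty
    exact D.lower (one_le_trace x) hx
  | insert a c hc ha _ ih =>
    obtain ⟨x, hx, h1, h2⟩ := D.directed _ (h a (Finset.mem_insert_self _ _)) _
      (ih fun b hb => h b (Finset.mem_insert_of_mem hb))
    refine D.lower (Clique.trace_le.2 fun b hb => ?_) hx
    rcases Finset.mem_insert.1 hb with rfl | hb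
    · exact h1
    · exact (letter_le_clique.2 hb).trans h2

/-- The ideal of those `w` with `u w ∈ D`. -/
def residual (D : Order.Ideal (TraceMonoid I)) (u : TraceMonoid I) (hu : u ∈ D) :
    Order.Ideal (TraceMonoid I) where
  carrier := {w | u * w ∈ D}
  lower' v w hvw hv := D.lower (mul_le_mul_iff.2 hvw) hv
  nonempty' := ⟨1, by simpa using hu⟩
  directed' v hv w hw := by
    obtain ⟨x, hx, h1, h2⟩ := D.directed _ hv _ hw
    obtain ⟨y, rfl⟩ := (le_mul_right u v).trans h1
    exact ⟨y, hx, mul_le_mul_iff.1 h1, mul_le_mul_iff.1 h2⟩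

lemma mem_residual {D : Order.Ideal (TraceMonoid I)} {u : TraceMonoid I} (hu : u ∈ D)
    {w : TraceMonoid I} : w ∈ residual D u hu ↔ u * w ∈ D := Iff.rfl

/-- `HasNext D u c` means that `u` lies in `D` and that `c` is the set of the letters by which it
can be extended within `D`. -/
def HasNext (D : Order.Ideal (TraceMonoid I)) (u : TraceMonoid I) (c : Clique I) : Prop :=
  u ∈ D ∧ ∀ a, u * letter I a ∈ D ↔ a ∈ c.1

/-- The product of the first `n` cliques of a sequence. -/
def cliqueProd (c : ℕ → Clique I) (n : ℕ) : TraceMonoid I :=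
  ((List.range n).map (fun i => (c i).trace)).prod

lemma cliqueProd_zero (c : ℕ → Clique I) : cliqueProd c 0 = 1 := rfl

lemma cliqueProd_succ (c : ℕ → Clique I) (n : ℕ) :
    cliqueProd c (n + 1) = cliqueProd c n * (c n).trace := by
  simp [cliqueProd, List.range_succ]

lemma cliqueProd_succ' (c : ℕ → Clique I) (n : ℕ) :
    cliqueProd c (n + 1) = (c 0).trace * cliqueProd (fun i => c (i + 1)) n := by
  simp [cliqueProd, List.range_succ_eq_map, Function.comp_def]

lemma cliqueProd_congr {c d : ℕ → Clique I} {n : ℕ} (h : ∀ i < n, c i = d i) :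
    cliqueProd c n = cliqueProd d n := by
  induction n with
  | zero => rfl
  | succ n ih =>
    rw [cliqueProd_succ, cliqueProd_succ, ih fun i hi => h i (by omega), h n (by omega)]

/-- The letters dividing a product of successively admissible cliques are those of the first
one. -/
lemma letter_le_cliqueProd {c : ℕ → Clique I} {n : ℕ}
    (hc : ∀ i < n, Admissible (c i) (c (i + 1))) {a : A} :
    letter I a ≤ cliqueProd c (n + 1) ↔ a ∈ (c 0).1 := by
  induction n generalizing c with
  | zero => rw [cliqueProd_succ, cliqueProd_zero, one_mul, letter_le_clique]
  | succ n ih =>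
    rw [cliqueProd_succ', letter_le_clique_mul, ih fun i hi => hc (i + 1) (by omega)]
    refine ⟨fun h => h.resolve_right fun ⟨h1, h2⟩ => ?_, .inl⟩
    obtain ⟨b, hb, hab⟩ := hc 0 (by omega) a h2
    exact hab (h1 b hb).symm

variable [Finite A]

/-- The clique of all letters of an ideal: the first clique of its Cartier–Foata sequence. -/
noncomputable def firstClique (D : Order.Ideal (TraceMonoid I)) : Clique I :=
  ⟨(Set.toFinite {a | letter I a ∈ D}).toFinset, by
    intro a ha b hb hab
    simp only [Set.Finite.coe_toFinset, Set.mem_ofPred_eq] at ha hb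
    obtain ⟨x, -, hax, q, rfl⟩ := D.directed _ ha _ hb
    exact ((letter_le_letter_mul.1 hax).resolve_left hab).1⟩

lemma mem_firstClique {D : Order.Ideal (TraceMonoid I)} {a : A} :
    a ∈ (firstClique D).1 ↔ letter I a ∈ D :=
  Set.Finite.mem_toFinset _

lemma firstClique_trace_mem (D : Order.Ideal (TraceMonoid I)) : (firstClique D).trace ∈ D :=
  Clique.trace_mem.2 fun _ => mem_firstClique.1

/-- What remains of an ideal once its first clique has been removed. -/
noncomputable def tail (D : Order.Ideal (TraceMonoid I)) : Order.Ideal (TraceMonoid I) :=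
  residual D _ (firstClique_trace_mem D)

lemma mem_tail {D : Order.Ideal (TraceMonoid I)} {w : TraceMonoid I} :
    w ∈ tail D ↔ (firstClique D).trace * w ∈ D := Iff.rfl

/-- The Cartier–Foata sequence of an ideal. Its terms may be empty: this happens from some index on
if the ideal is principal. -/
noncomputable def cfSeq (D : Order.Ideal (TraceMonoid I)) (n : ℕ) : Clique I :=
  firstClique (tail^[n] D)

lemma cfSeq_succ (D : Order.Ideal (TraceMonoid I)) (n : ℕ) :
    cfSeq D (n + 1) = cfSeq (tail D) n := rfl

lemma admissible_cfSeq (D : Order.Ideal (TraceMonoid I)) (n : ℕ) :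
    Admissible (cfSeq D n) (cfSeq D (n + 1)) := by
  induction n generalizing D with
  | succ n ih => exact ih (tail D)
  | zero =>
    intro b hb
    by_contra! h
    have hb' : (firstClique D).trace * letter I b ∈ D := mem_firstClique.1 hb
    rw [Clique.trace_mul_letter (c := firstClique D) fun a ha => (h a ha).symm] at hb'
    have hbc : b ∈ (firstClique D).1 := mem_firstClique.2 (D.lower (le_mul_right _ _) hb')
    exact I.loopless.irrefl _ (h b hbc)

lemma mem_iterate_tail {D : Order.Ideal (TraceMonoid I)} {n : ℕ} {w : TraceMonoid I} :
    w ∈ tail^[n] D ↔ cliqueProd (cfSeq D) n * w ∈ D := by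
  induction n generalizing D with
  | zero => simp [cliqueProd_zero]
  | succ n ih =>
    rw [Function.iterate_succ_apply, ih, cliqueProd_succ', mem_tail, mul_assoc]
    rfl

lemma cliqueProd_cfSeq_mem (D : Order.Ideal (TraceMonoid I)) (n : ℕ) :
    cliqueProd (cfSeq D) n ∈ D := by
  have : (1 : TraceMonoid I) ∈ tail^[n] D := by
    obtain ⟨x, hx⟩ := (tail^[n] D).nonempty
    exact Order.Ideal.lower _ (one_le_trace x) hx
  simpa using mem_iterate_tail.1 this

lemma mem_cfSeq {D : Order.Ideal (TraceMonoid I)} {n : ℕ} {a : A} :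
    a ∈ (cfSeq D n).1 ↔ cliqueProd (cfSeq D) n * letter I a ∈ D :=
  mem_firstClique.trans mem_iterate_tail

/-- The members of an ideal are exhausted by the partial products of its Cartier–Foata sequence. -/
lemma le_cliqueProd_cfSeq {D : Order.Ideal (TraceMonoid I)} {u : TraceMonoid I} (hu : u ∈ D)
    {n : ℕ} (hn : length u ≤ n) : u ≤ cliqueProd (cfSeq D) n := by
  induction n generalizing D u with
  | zero =>
    rw [eq_one_of_length u (by omega)]
    exact one_le_trace _
  | succ n ih =>
    by_cases h1 : u = 1
    · rw [h1]
      exact one_le_trace _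
    obtain ⟨a, ha⟩ := exists_letter_le h1
    obtain ⟨x, hx, hcx, hux⟩ := D.directed _ (firstClique_trace_mem D) _ hu
    obtain ⟨w, -, h2, h3, h4⟩ := exists_clique_mul_between hcx hux
    have h5 := h4 ⟨a, mem_firstClique.2 (D.lower ha hu), ha⟩
    have h6 : w ∈ tail D := D.lower h3 hx
    rw [cliqueProd_succ']
    exact h2.trans (mul_le_mul_iff.2 (ih h6 (by omega)))

lemma mem_iff_le_cliqueProd_cfSeq {D : Order.Ideal (TraceMonoid I)} {u : TraceMonoid I}
    {n : ℕ} (hn : length u ≤ n) : u ∈ D ↔ u ≤ cliqueProd (cfSeq D) n :=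
  ⟨fun h => le_cliqueProd_cfSeq h hn, fun h => D.lower h (cliqueProd_cfSeq_mem D n)⟩

/-- The Cartier–Foata sequence of `D` starts with a given admissible sequence if and only if the
last clique of the latter consists of the letters extending the product of the others within `D`.
The cliques before the last one then need no condition of their own: a further letter of the first
clique would commute with the first given clique and so belong to the second one, against
admissibility. -/
lemma cfSeq_eq_iff_hasNext {D : Order.Ideal (TraceMonoid I)} {c : ℕ → Clique I} {n : ℕ}
    (hc : ∀ i < n, Admissible (c i) (c (i + 1))) :
    (∀ i ≤ n, cfSeq D i = c i) ↔ HasNext D (cliqueProd c n) (c n) := by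
  constructor
  · intro h
    rw [HasNext, ← cliqueProd_congr fun i hi => h i hi.le, ← h n le_rfl]
    exact ⟨cliqueProd_cfSeq_mem D n, fun a => mem_cfSeq.symm⟩
  · intro h
    induction n generalizing D c with
    | zero =>
      intro i hi
      obtain rfl : i = 0 := by omega
      refine Subtype.ext (Finset.ext fun a => ?_)
      rw [← h.2 a, mem_cfSeq]
      rfl
    | succ n ih =>
      rw [HasNext, cliqueProd_succ'] at h
      have h0 : (c 0).trace ∈ D := D.lower (le_mul_right _ _) h.1
      have h1 : HasNext (residual D _ h0) (cliqueProd (fun i => c (i + 1)) n) (c (n + 1)) :=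
        ⟨h.1, fun a => by rw [← h.2 a, mem_residual, mul_assoc]⟩
      have h2 := ih (fun i hi => hc (i + 1) (by omega)) h1
      have h3 : firstClique D = c 0 := by
        refine Subtype.ext (Finset.ext fun a => ?_)
        refine mem_firstClique.trans ⟨fun ha => ?_, fun ha => Clique.trace_mem.1 h0 a ha⟩
        by_contra hac
        obtain ⟨h4, h5⟩ := (letter_le_or_commute_of_mem ha h0).resolve_left
          fun h => hac (letter_le_clique.1 h)
        have h6 : a ∈ (c 1).1 := by
          rw [← h2 0 (by omega)]
          exact mem_firstClique.2 h5
        obtain ⟨b, hb, hab⟩ := hc 0 (by omega) a h6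
        have h7 : letter I b ≤ letter I a * (c 0).trace := by
          rw [← h4]
          exact (letter_le_clique.2 hb).trans (le_mul_right _ _)
        rcases letter_le_letter_mul.1 h7 with rfl | h8
        · exact hac hb
        · exact hab h8.1
      intro i hi
      rcases i with _ | i
      · exact h3
      · rw [cfSeq_succ, ← h2 i (by omega)]
        congr 1
        simp only [tail, h3]

/-- An ideal whose Cartier–Foata sequence has an empty term is principal. -/
lemma mem_iff_le_of_cfSeq_empty {D : Order.Ideal (TraceMonoid I)} {n : ℕ}
    (h : ∀ a, a ∉ (cfSeq D n).1) {u : TraceMonoid I} : u ∈ D ↔ u ≤ cliqueProd (cfSeq D) n := by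
  refine ⟨fun hu => ?_, fun hu => D.lower hu (cliqueProd_cfSeq_mem D n)⟩
  obtain ⟨x, hx, hux, w, rfl⟩ := D.directed _ hu _ (cliqueProd_cfSeq_mem D n)
  have hw : w = 1 := by
    by_contra hw
    obtain ⟨a, ha⟩ := exists_letter_le hw
    exact h a (mem_cfSeq.2 (D.lower (mul_le_mul_iff.2 ha) hx))
  rwa [hw, mul_one] at hux

end Ideals

section Boundary

variable {A : Type*} {I : SimpleGraph A}

/-! ### The boundary and the space of paths -/

lemma embed_le_iff {u : TraceMonoid I} {s : NDSeq I} :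
    embed u ≤ toAntisymmetrization (· ≤ ·) s ↔ ∃ k, u ≤ s.1 k := by
  exact Iff.trans toAntisymmetrization_le_toAntisymmetrization_iff
    ⟨fun h => h 0, fun h _ => h⟩

lemma embed_le_embed {u v : TraceMonoid I} : embed u ≤ embed v ↔ u ≤ v :=
  embed_le_iff.trans ⟨fun ⟨_, h⟩ => h, fun h => ⟨0, h⟩⟩

lemma genTrace_le_iff {ξ η : GenTrace I} :
    ξ ≤ η ↔ ∀ u : TraceMonoid I, embed u ≤ ξ → embed u ≤ η := by
  refine ⟨fun h u hu => hu.trans h, fun h => ?_⟩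
  induction ξ using Antisymmetrization.ind with | _ s
  induction η using Antisymmetrization.ind with | _ t
  rw [toAntisymmetrization_le_toAntisymmetrization_iff]
  exact fun k => embed_le_iff.1 (h _ (embed_le_iff.2 ⟨k, le_rfl⟩))

/-- The ideal of the traces below a generalized trace. -/
def idealOf (ξ : GenTrace I) : Order.Ideal (TraceMonoid I) where
  carrier := {u | embed u ≤ ξ}
  lower' _ _ hvw hv := (embed_le_embed.2 hvw).trans hv
  nonempty' := by
    induction ξ using Antisymmetrization.ind with | _ s
    exact ⟨s.1 0, embed_le_iff.2 ⟨0, le_rfl⟩⟩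
  directed' := by
    induction ξ using Antisymmetrization.ind with | _ s
    intro v hv w hw
    obtain ⟨k, hk⟩ := embed_le_iff.1 hv
    obtain ⟨l, hl⟩ := embed_le_iff.1 hw
    have hs : Monotone s.1 := monotone_nat_of_le_succ s.2
    exact ⟨s.1 (max k l), embed_le_iff.2 ⟨_, le_rfl⟩, hk.trans (hs (le_max_left _ _)),
      hl.trans (hs (le_max_right _ _))⟩

/-- The sequence of cliques underlying a path. -/
def cliques (ω : Path I) (k : ℕ) : Clique I := (ω.1 k).1

lemma cliques_nonempty (ω : Path I) (k : ℕ) : (cliques ω k).1.Nonempty := (ω.1 k).2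

lemma partialProd_eq (ω : Path I) (k : ℕ) : ω.partialProd k = cliqueProd (cliques ω) (k + 1) := rfl

lemma monotone_cliqueProd (c : ℕ → Clique I) : Monotone (cliqueProd c) :=
  monotone_nat_of_le_succ fun n => by
    rw [cliqueProd_succ]
    exact le_mul_right _ _

lemma le_length_cliqueProd (ω : Path I) (n : ℕ) : n ≤ length (cliqueProd (cliques ω) n) := by
  induction n with
  | zero => exact Nat.zero_le _
  | succ n ih =>
    have := (cliques_nonempty ω n).card_pos
    rw [cliqueProd_succ, length_mul, Clique.length_trace]
    omega

/-- The supremum of the partial products of a path, as a point of the boundary. -/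
def ofPath (ω : Path I) : Boundary I :=
  ⟨toAntisymmetrization (· ≤ ·)
    ⟨ω.partialProd, fun k => monotone_cliqueProd (cliques ω) (Nat.le_succ (k + 1))⟩, by
    rintro ⟨u, hu⟩
    have h : embed (ω.partialProd (length u)) ≤ embed u := by
      rw [hu]
      exact embed_le_iff.2 ⟨_, le_rfl⟩
    have h1 := length_le (embed_le_embed.1 h)
    have h2 := le_length_cliqueProd ω (length u + 1)
    rw [partialProd_eq] at h1
    omega⟩

lemma mem_idealOf_ofPath {ω : Path I} {u : TraceMonoid I} :
    u ∈ idealOf (ofPath ω).1 ↔ ∃ n, u ≤ cliqueProd (cliques ω) n := by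
  refine embed_le_iff.trans ⟨fun ⟨k, h⟩ => ⟨k + 1, h⟩, fun ⟨k, h⟩ => ⟨k, h.trans ?_⟩⟩
  exact monotone_cliqueProd _ (Nat.le_succ k)

variable [Finite A]

lemma cfSeq_ofPath (ω : Path I) (n : ℕ) : cfSeq (idealOf (ofPath ω).1) n = cliques ω n := by
  refine (cfSeq_eq_iff_hasNext (c := cliques ω) fun i _ => ω.2 i).2
    ⟨mem_idealOf_ofPath.2 ⟨n, le_rfl⟩, fun a => ?_⟩ n le_rfl
  rw [mem_idealOf_ofPath]
  constructor
  · rintro ⟨m, hm⟩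
    obtain ⟨k, hk⟩ : ∃ k, n + (k + 1) = n + m + 1 := ⟨m, by omega⟩
    have h1 := hm.trans (monotone_cliqueProd (cliques ω) (show m ≤ n + (k + 1) by omega))
    have h2 : ∀ k, cliqueProd (cliques ω) (n + k) =
        cliqueProd (cliques ω) n * cliqueProd (fun i => cliques ω (n + i)) k := by
      intro k
      induction k with
      | zero => simp [cliqueProd_zero]
      | succ k ih => rw [← add_assoc, cliqueProd_succ, ih, cliqueProd_succ, mul_assoc]
    rw [h2, mul_le_mul_iff,
      letter_le_cliqueProd (c := fun i => cliques ω (n + i)) fun i _ => ω.2 (n + i)] at h1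
    exact h1
  · intro ha
    refine ⟨n + 1, ?_⟩
    rw [cliqueProd_succ, mul_le_mul_iff]
    exact letter_le_clique.2 ha

lemma cfSeq_nonempty (ξ : Boundary I) (n : ℕ) : (cfSeq (idealOf ξ.1) n).1.Nonempty := by
  by_contra h
  rw [Finset.not_nonempty_iff_eq_empty] at h
  have h1 : ∀ a, a ∉ (cfSeq (idealOf ξ.1) n).1 := by simp [h]
  refine ξ.2 ⟨cliqueProd (cfSeq (idealOf ξ.1)) n, ?_⟩
  refine le_antisymm (cliqueProd_cfSeq_mem (idealOf ξ.1) n) (genTrace_le_iff.2 fun u hu => ?_)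
  exact embed_le_embed.2 ((mem_iff_le_of_cfSeq_empty h1).1 hu)

/-- The path of the cliques of an infinite trace. -/
noncomputable def toPath (ξ : Boundary I) : Path I :=
  ⟨fun k => ⟨cfSeq (idealOf ξ.1) k, cfSeq_nonempty ξ k⟩, fun k => admissible_cfSeq (idealOf ξ.1) k⟩

lemma cliques_toPath (ξ : Boundary I) : cliques (toPath ξ) = cfSeq (idealOf ξ.1) := rfl

lemma ofPath_toPath (ξ : Boundary I) : ofPath (toPath ξ) = ξ := by
  have h (u : TraceMonoid I) : u ∈ idealOf (ofPath (toPath ξ)).1 ↔ u ∈ idealOf ξ.1 := by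
    rw [mem_idealOf_ofPath, cliques_toPath]
    exact ⟨fun ⟨n, h⟩ => (idealOf ξ.1).lower h (cliqueProd_cfSeq_mem _ n),
      fun h => ⟨length u, le_cliqueProd_cfSeq h le_rfl⟩⟩
  exact Subtype.ext (le_antisymm (genTrace_le_iff.2 fun u => (h u).1)
    (genTrace_le_iff.2 fun u => (h u).2))

lemma toPath_ofPath (ω : Path I) : toPath (ofPath ω) = ω :=
  Subtype.ext (funext fun k => Subtype.ext (cfSeq_ofPath ω k))

lemma isLUB_partialProd_toPath (ξ : Boundary I) :
    IsLUB (Set.range fun k => embed ((toPath ξ).partialProd k)) ξ.1 := by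
  constructor
  · rintro _ ⟨k, rfl⟩
    exact cliqueProd_cfSeq_mem (idealOf ξ.1) (k + 1)
  · intro η hη
    refine genTrace_le_iff.2 fun u hu => ?_
    refine (embed_le_embed.2 ?_).trans (hη ⟨length u, rfl⟩)
    exact le_cliqueProd_cfSeq (D := idealOf ξ.1) hu (Nat.le_succ _)

/-! ### Measurability -/

/-- The paths with given first `n + 1` cliques. -/
def pathCyl (x : ℕ → NECliq I) (n : ℕ) : Set (Path I) := {ω | ∀ i ≤ n, coord i ω = x i}

omit [Finite A] in
lemma measurable_coord (k : ℕ) : Measurable (coord (I := I) k) :=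
  (measurable_pi_apply k).comp measurable_subtype_coe

omit [Finite A] in
lemma measurableSet_pathCyl (x : ℕ → NECliq I) (n : ℕ) : MeasurableSet (pathCyl x n) := by
  have : pathCyl x n = ⋂ i ≤ n, coord i ⁻¹' {x i} := by ext; simp [pathCyl]
  rw [this]
  exact .biInter (Set.to_countable _) fun i _ => measurable_coord i trivial

lemma measurableSpace_path_eq :
    (inferInstance : MeasurableSpace (Path I)) =
      MeasurableSpace.generateFrom {s | ∃ x n, s = pathCyl x n} := by
  refine le_antisymm ?_ (MeasurableSpace.generateFrom_le ?_)
  · have key : ∀ k, @Measurable _ _ (MeasurableSpace.generateFrom {s | ∃ x n, s = pathCyl x n}) _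
        (coord (I := I) k) := by
      intro k
      refine @measurable_to_countable' _ _ _ _ (MeasurableSpace.generateFrom _) _ fun y => ?_
      have : coord (I := I) k ⁻¹' {y} = ⋃ x ∈ {x : Fin (k + 1) → NECliq I | x (Fin.last k) = y},
          pathCyl (fun i => x (Fin.ofNat (k + 1) i)) k := by
        ext ω
        simp only [Set.mem_preimage, Set.mem_singleton_iff, Set.mem_iUnion, pathCyl]
        constructor
        · intro h
          refine ⟨fun i => coord i ω, by simpa using h, fun i hi => ?_⟩
          simp [Nat.mod_eq_of_lt (Nat.lt_succ_of_le hi)]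
        · rintro ⟨x, hx, h⟩
          rw [h k le_rfl, ← hx]
          congr 1
          ext
          simp
      rw [this]
      exact MeasurableSet.biUnion (Set.to_countable _) fun x _ =>
        MeasurableSpace.measurableSet_generateFrom ⟨_, _, rfl⟩
    rintro s ⟨t, ht, rfl⟩
    have h : @Measurable _ _ (MeasurableSpace.generateFrom {s | ∃ x n, s = pathCyl (I := I) x n}) _
        (fun ω : Path I => ω.1) := @measurable_pi_lambda _ _ _ (_) _ _ key
    exact h ht
  · rintro _ ⟨x, n, rfl⟩
    exact measurableSet_pathCyl x n

omit [Finite A] in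
lemma measurableSet_cyl (u : TraceMonoid I) : MeasurableSet (cyl u) :=
  MeasurableSpace.measurableSet_generateFrom ⟨u, rfl⟩

lemma measurableSet_hasNext (u : TraceMonoid I) (c : Clique I) :
    MeasurableSet {ξ : Boundary I | HasNext (idealOf ξ.1) u c} := by
  classical
  have : {ξ : Boundary I | HasNext (idealOf ξ.1) u c} =
      cyl u ∩ ⋂ a, if a ∈ c.1 then cyl (u * letter I a) else (cyl (u * letter I a))ᶜ := by
    ext ξ
    simp only [HasNext, Set.mem_inter_iff, Set.mem_iInter]
    refine and_congr Iff.rfl (forall_congr' fun a => ?_)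
    split_ifs with h
    · exact ⟨fun h' => h'.2 h, fun h' => ⟨fun _ => h, fun _ => h'⟩⟩
    · exact ⟨fun h' h'' => h (h'.1 h''),
        fun h' => ⟨fun h'' => absurd h'' h', fun h'' => absurd h'' h⟩⟩
  rw [this]
  refine (measurableSet_cyl u).inter (.iInter fun a => ?_)
  split_ifs
  · exact measurableSet_cyl _
  · exact (measurableSet_cyl _).compl

omit [Finite A] in
lemma pathCyl_eq_empty {x : ℕ → NECliq I} {n : ℕ}
    (h : ¬ ∀ i < n, Admissible (x i).1 (x (i + 1)).1) : pathCyl x n = ∅ := by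
  rw [Set.eq_empty_iff_forall_notMem]
  refine fun ω hω => h fun i hi => ?_
  rw [← hω i hi.le, ← hω (i + 1) hi]
  exact ω.2 i

lemma toPath_mem_pathCyl {x : ℕ → NECliq I} {n : ℕ}
    (h : ∀ i < n, Admissible (x i).1 (x (i + 1)).1) {ξ : Boundary I} :
    toPath ξ ∈ pathCyl x n ↔
      HasNext (idealOf ξ.1) (cliqueProd (fun i => (x i).1) n) (x n).1 := by
  rw [← cfSeq_eq_iff_hasNext (c := fun i => (x i).1) h]
  exact forall₂_congr fun i hi => Subtype.ext_iff

lemma measurableSet_preimage_pathCyl (x : ℕ → NECliq I) (n : ℕ) :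
    MeasurableSet (toPath ⁻¹' pathCyl x n) := by
  by_cases h : ∀ i < n, Admissible (x i).1 (x (i + 1)).1
  · have : toPath ⁻¹' pathCyl x n =
        {ξ | HasNext (idealOf ξ.1) (cliqueProd (fun i => (x i).1) n) (x n).1} := by
      ext ξ
      exact toPath_mem_pathCyl h
    rw [this]
    exact measurableSet_hasNext _ _
  · rw [pathCyl_eq_empty h]
    exact MeasurableSet.empty

lemma measurable_toPath : Measurable (toPath (I := I)) := by
  have key : @Measurable _ _ _ (MeasurableSpace.generateFrom {s | ∃ x n, s = pathCyl (I := I) x n})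
      (toPath (I := I)) := by
    refine measurable_generateFrom ?_
    rintro _ ⟨x, n, rfl⟩
    exact measurableSet_preimage_pathCyl x n
  rwa [← measurableSpace_path_eq] at key

lemma measurable_ofPath : Measurable (ofPath (I := I)) := by
  refine measurable_generateFrom ?_
  rintro _ ⟨u, rfl⟩
  have : ofPath ⁻¹' cyl u =
      ⋃ n, {ω : Path I | u ≤ cliqueProd (cliques ω) n} := by
    ext ω
    rw [Set.mem_iUnion]
    exact mem_idealOf_ofPath
  rw [this]
  refine .iUnion fun n => ?_
  have h : Measurable fun (ω : Path I) (i : Fin n) => coord i ω :=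
    measurable_pi_lambda _ fun i => measurable_coord i
  have h' : {ω : Path I | u ≤ cliqueProd (cliques ω) n} = (fun ω (i : Fin n) => coord i ω) ⁻¹'
      ((fun ω (i : Fin n) => coord i ω) '' {ω : Path I | u ≤ cliqueProd (cliques ω) n}) := by
    refine Set.Subset.antisymm (Set.subset_preimage_image _ _) ?_
    rintro ω ⟨ω', hω', h⟩
    change u ≤ _
    rw [cliqueProd_congr (c := cliques ω) (d := cliques ω') fun i hi =>
      congrArg Subtype.val (congrFun h ⟨i, hi⟩).symm]
    exact hω'
  rw [h']
  exact h (Set.toFinite _).measurableSet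

/-- The bi-measurable bijection between the boundary and the space of paths. -/
noncomputable def boundaryEquiv (I : SimpleGraph A) : Boundary I ≃ᵐ Path I where
  toFun := toPath
  invFun := ofPath
  left_inv := ofPath_toPath
  right_inv := toPath_ofPath
  measurable_toFun := measurable_toPath
  measurable_invFun := measurable_ofPath

end Boundary

section Mobius

variable {A : Type*} {I : SimpleGraph A}

/-! ### Alternating sums over cliques -/

lemma IsValuation.map_one {f : TraceMonoid I → ℝ} (hf : IsValuation f) : f 1 = 1 := by
  have h1 := hf.2 1 1
  rw [mul_one] at h1
  exact mul_left_cancel₀ (hf.1 1).ne' (by rw [mul_one]; exact h1.symm)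

lemma neg_one_pow_sub {m n : ℕ} (h : n ≤ m) : (-1 : ℝ) ^ (m - n) = (-1) ^ m * (-1) ^ n := by
  obtain ⟨k, rfl⟩ := Nat.exists_eq_add_of_le h
  rw [Nat.add_sub_cancel_left, pow_add, mul_right_comm, ← mul_pow]
  simp

open Classical in
lemma sum_powerset_neg_one_pow_sub {s e : Finset A} (h : s ⊆ e) :
    ∑ d ∈ s.powerset, (-1 : ℝ) ^ (e.card - d.card) = if s = ∅ then (-1) ^ e.card else 0 := by
  have h1 : ∑ d ∈ s.powerset, (-1 : ℝ) ^ d.card = if s = ∅ then 1 else 0 := by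
    exact_mod_cast congrArg (Int.cast (R := ℝ)) (Finset.sum_powerset_neg_one_pow_card (x := s))
  rw [Finset.sum_congr rfl fun d hd => neg_one_pow_sub
    (Finset.card_le_card ((Finset.mem_powerset.1 hd).trans h)), ← Finset.mul_sum, h1]
  simp

variable [Finite A]

open Classical in
lemma sum_clique_subset (φ : Finset A → ℝ) {s : Finset A} (hs : I.IsClique (s : Set A)) :
    ∑ d : Clique I with d.1 ⊆ s, φ d.1 = ∑ d ∈ s.powerset, φ d := by
  refine Finset.sum_nbij (fun d => d.1) (fun d hd => by simpa using hd)
    (fun c _ d _ h => Subtype.ext h) (fun d hd => ?_) fun _ _ => rfl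
  have hd' : d ⊆ s := by simpa using hd
  exact ⟨⟨d, hs.subset (by exact_mod_cast hd')⟩, Finset.mem_filter.2 ⟨Finset.mem_univ _, hd'⟩, rfl⟩

open Classical in
/-- The alternating sum over the cliques between `c` and `e`. -/
lemma sum_clique_between (c e : Clique I) :
    ∑ d : Clique I with c.1 ⊆ d.1, (-1 : ℝ) ^ (d.1.card - c.1.card) * (if d.1 ⊆ e.1 then 1 else 0) =
      if c = e then 1 else 0 := by
  by_cases hce : c.1 ⊆ e.1
  · have h1 : ∑ d : Clique I with c.1 ⊆ d.1,
        (-1 : ℝ) ^ (d.1.card - c.1.card) * (if d.1 ⊆ e.1 then 1 else 0) =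
        ∑ d : Clique I with d.1 ⊆ e.1,
          (if c.1 ⊆ d.1 then (-1 : ℝ) ^ (d.1.card - c.1.card) else 0) := by
      rw [Finset.sum_filter, Finset.sum_filter]
      refine Finset.sum_congr rfl fun d _ => ?_
      by_cases h1 : c.1 ⊆ d.1 <;> by_cases h2 : d.1 ⊆ e.1 <;> simp only [h1, h2, if_true, if_false,
        mul_one, mul_zero]
    refine h1.trans ((sum_clique_subset (fun s : Finset A =>
      if c.1 ⊆ s then (-1 : ℝ) ^ (s.card - c.1.card) else 0) e.2).trans ?_)
    rw [← Finset.sum_filter]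
    have h2 : ∑ s ∈ e.1.powerset with c.1 ⊆ s, (-1 : ℝ) ^ (s.card - c.1.card) =
        ∑ s ∈ (e.1 \ c.1).powerset, (-1 : ℝ) ^ s.card := by
      refine Finset.sum_nbij' (fun s => s \ c.1) (fun s => s ∪ c.1) ?_ ?_ ?_ ?_ ?_
      · intro s hs
        simp only [Finset.mem_filter, Finset.mem_powerset] at hs ⊢
        exact Finset.sdiff_subset_sdiff hs.1 subset_rfl
      · intro s hs
        simp only [Finset.mem_filter, Finset.mem_powerset] at hs ⊢
        exact ⟨Finset.union_subset (hs.trans Finset.sdiff_subset) hce, Finset.subset_union_right⟩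
      · intro s hs
        exact Finset.sdiff_union_of_subset (Finset.mem_filter.1 hs).2
      · intro s hs
        refine Finset.union_sdiff_cancel_right ?_
        exact Finset.disjoint_of_subset_left (Finset.mem_powerset.1 hs) Finset.sdiff_disjoint
      · intro s hs
        rw [Finset.card_sdiff_of_subset (Finset.mem_filter.1 hs).2]
    rw [h2]
    have h3 : ∑ s ∈ (e.1 \ c.1).powerset, (-1 : ℝ) ^ s.card = if e.1 \ c.1 = ∅ then 1 else 0 := by
      exact_mod_cast congrArg (Int.cast (R := ℝ))
        (Finset.sum_powerset_neg_one_pow_card (x := e.1 \ c.1))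
    rw [h3]
    refine if_congr ?_ rfl rfl
    rw [Finset.sdiff_eq_empty_iff_subset]
    exact ⟨fun h => Subtype.ext (hce.antisymm h), fun h => by rw [h]⟩
  · rw [if_neg fun h => hce (by rw [h])]
    refine Finset.sum_eq_zero fun d hd => ?_
    rw [if_neg fun h => hce ((Finset.mem_filter.1 hd).2.trans h), mul_zero]

open Classical in
lemma mobius_eq (f : TraceMonoid I → ℝ) (c : Clique I) :
    mobius f c = ∑ d : Clique I with c.1 ⊆ d.1, (-1) ^ (d.1.card - c.1.card) * f d.trace := by
  rw [mobius]
  refine Finset.sum_congr ?_ fun d _ => by rw [Clique.length_trace, Clique.length_trace]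
  ext d
  simp [Clique.trace_le_trace]

open Classical in
/-- Möbius inversion for the indicator functions of the cylinders `u d`, where `d` is a clique,
evaluated at an ideal. -/
lemma sum_indicator_mem (D : Order.Ideal (TraceMonoid I)) (u : TraceMonoid I) (c : Clique I) :
    ∑ d : Clique I with c.1 ⊆ d.1, (-1 : ℝ) ^ (d.1.card - c.1.card) *
      (if u * d.trace ∈ D then 1 else 0) = if HasNext D u c then 1 else 0 := by
  by_cases hu : u ∈ D
  · have h (d : Clique I) : u * d.trace ∈ D ↔ d.1 ⊆ (firstClique (residual D u hu)).1 := by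
      rw [← mem_residual hu, Clique.trace_mem]
      exact forall₂_congr fun a _ => mem_firstClique.symm
    simp only [h]
    rw [sum_clique_between]
    refine if_congr ?_ rfl rfl
    constructor
    · rintro rfl
      exact ⟨hu, fun a => (mem_firstClique (D := residual D u hu)).symm⟩
    · intro h
      exact Subtype.ext (Finset.ext fun a => (h.2 a).symm.trans
        (mem_firstClique (D := residual D u hu)).symm)
  · rw [if_neg fun h => hu h.1]
    refine Finset.sum_eq_zero fun d _ => ?_
    have h : u * d.trace ∉ D := fun h => hu (D.lower (le_mul_right _ _) h)
    simp only [h, if_false, mul_zero]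

open Classical in
/-- Summing the Möbius transform over all cliques of letters with property `p` leaves an alternating
sum over the cliques of letters without property `p`. -/
lemma sum_mobius_filter (f : TraceMonoid I → ℝ) {p : A → Prop} {q r : Clique I → Prop}
    [DecidablePred q] [DecidablePred r] (hq : ∀ d, q d ↔ ∀ b ∈ d.1, p b)
    (hr : ∀ e, r e ↔ ∀ b ∈ e.1, ¬ p b) :
    ∑ d : Clique I with q d, mobius f d =
      ∑ e : Clique I with r e, (-1) ^ e.1.card * f e.trace := by
  simp only [mobius_eq, Finset.sum_filter]
  have h1 (d : Clique I) : (if q d then ∑ e : Clique I,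
      if d.1 ⊆ e.1 then (-1 : ℝ) ^ (e.1.card - d.1.card) * f e.trace else 0 else 0) =
      ∑ e : Clique I, (if d.1 ⊆ e.1.filter p then (-1 : ℝ) ^ (e.1.card - d.1.card) else 0) *
        f e.trace := by
    by_cases h : ∀ b ∈ d.1, p b
    · rw [if_pos ((hq d).2 h)]
      refine Finset.sum_congr rfl fun e _ => ?_
      have : d.1 ⊆ e.1.filter p ↔ d.1 ⊆ e.1 :=
        ⟨fun h' => h'.trans (Finset.filter_subset _ _),
          fun h' b hb => Finset.mem_filter.2 ⟨h' hb, h b hb⟩⟩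
      simp only [this]
      split_ifs <;> simp
    · rw [if_neg fun h' => h ((hq d).1 h'), Finset.sum_eq_zero]
      intro e _
      rw [if_neg fun h' => h fun b hb => (Finset.mem_filter.1 (h' hb)).2, zero_mul]
  rw [Finset.sum_congr rfl fun d _ => h1 d, Finset.sum_comm]
  refine Finset.sum_congr rfl fun e _ => ?_
  have hcl : I.IsClique ((e.1.filter p : Finset A) : Set A) :=
    e.2.subset (by exact_mod_cast Finset.filter_subset _ _)
  rw [← Finset.sum_mul, ← Finset.sum_filter,
    sum_clique_subset (fun s => (-1 : ℝ) ^ (e.1.card - s.card)) hcl,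
    sum_powerset_neg_one_pow_sub (Finset.filter_subset _ _)]
  by_cases h : ∀ b ∈ e.1, ¬ p b
  · rw [if_pos ((hr e).2 h), if_pos (Finset.filter_eq_empty_iff.2 h)]
  · rw [if_neg fun h' => h ((hr e).1 h'),
      if_neg fun h' => h (Finset.filter_eq_empty_iff.1 h'), zero_mul]

lemma sum_mobius (f : TraceMonoid I → ℝ) : ∑ c : Clique I, mobius f c = f 1 := by
  classical
  have h := sum_mobius_filter f (p := fun _ => True) (q := fun _ => True)
    (r := fun e : Clique I => e = Clique.empty I) (by simp) fun e => by
      exact (Subtype.ext_iff.trans (Finset.eq_empty_iff_forall_notMem (s := e.1))).trans (by simp)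
  rw [Finset.filter_true, Finset.sum_filter, Finset.sum_ite_eq' , if_pos (Finset.mem_univ _)] at h
  rw [h, Clique.trace_empty]
  simp [Clique.empty]

lemma sum_necliq {φ : Clique I → ℝ} (h : φ (Clique.empty I) = 0) :
    ∑ c : NECliq I, φ c.1 = ∑ c : Clique I, φ c := by
  refine Finset.sum_of_injOn (fun c => c.1) (fun c _ d _ h => Subtype.ext h)
    (fun _ _ => Finset.mem_coe.2 (Finset.mem_univ _)) ?_ fun _ _ => rfl
  intro c _ hc
  rcases c.1.eq_empty_or_nonempty with he | hne
  · rw [show c = Clique.empty I from Subtype.ext he, h]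
  · exact absurd ⟨⟨c, hne⟩, Finset.mem_coe.2 (Finset.mem_univ _), rfl⟩ hc

open Classical in
/-- The Möbius transform at `c` as a sum over the cliques parallel to `c`. -/
lemma mobius_eq_mul_sum {f : TraceMonoid I → ℝ} (hf : IsValuation f) (c : Clique I) :
    mobius f c = f c.trace *
      ∑ s : Clique I with ∀ b ∈ s.1, ∀ a ∈ c.1, I.Adj a b, (-1) ^ s.1.card * f s.trace := by
  have hu (s : Clique I) (h : ∀ b ∈ s.1, ∀ a ∈ c.1, I.Adj a b) :
      I.IsClique ((c.1 ∪ s.1 : Finset A) : Set A) := by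
    intro a ha b hb hab
    simp only [Finset.coe_union, Set.mem_union, Finset.mem_coe] at ha hb
    rcases ha with ha | ha <;> rcases hb with hb | hb
    · exact c.2 ha hb hab
    · exact h b hb a ha
    · exact (h a ha b hb).symm
    · exact s.2 ha hb hab
  have hd (s : Clique I) (h : ∀ b ∈ s.1, ∀ a ∈ c.1, I.Adj a b) : Disjoint c.1 s.1 :=
    Finset.disjoint_left.2 fun a ha hb => I.loopless.irrefl _ (h a hb a ha)
  rw [mobius_eq, Finset.mul_sum]
  symm
  refine Finset.sum_bij' (fun s hs => ⟨c.1 ∪ s.1, hu s (Finset.mem_filter.1 hs).2⟩)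
    (fun d _ => ⟨d.1 \ c.1, d.2.subset (by exact_mod_cast Finset.sdiff_subset)⟩) ?_ ?_ ?_ ?_ ?_
  · intro s hs
    exact Finset.mem_filter.2 ⟨Finset.mem_univ _, Finset.subset_union_left⟩
  · intro d hd
    refine Finset.mem_filter.2 ⟨Finset.mem_univ _, fun b hb a ha => ?_⟩
    have hb := Finset.mem_sdiff.1 hb
    exact d.2 ((Finset.mem_filter.1 hd).2 ha) hb.1 fun h => hb.2 (h ▸ ha)
  · intro s hs
    exact Subtype.ext (Finset.union_sdiff_cancel_left (hd s (Finset.mem_filter.1 hs).2))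
  · intro d hd
    exact Subtype.ext (Finset.union_sdiff_of_subset (Finset.mem_filter.1 hd).2)
  · intro s hs
    have hs' := (Finset.mem_filter.1 hs).2
    rw [Clique.trace_union (fun a ha b hb => hs' b hb a ha) (hu s hs'), hf.2]
    change _ = (-1) ^ ((c.1 ∪ s.1).card - c.1.card) * _
    rw [Finset.card_union_of_disjoint (hd s hs'), Nat.add_sub_cancel_left]
    ring

/-- If the Möbius transform vanishes at the empty clique, then the normalizing factor `g c` is
`h c / f c`. -/
lemma mobius_eq_mul_normalization {f : TraceMonoid I → ℝ} (hf : IsValuation f)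
    (h0 : mobius f (Clique.empty I) = 0) (c : NECliq I) :
    mobius f c.1 = f c.trace * normalization (mobius f) c := by
  classical
  have h2 : normalization (mobius f) c =
      ∑ d : Clique I, if Admissible c.1 d then mobius f d else 0 := by
    refine Eq.trans ?_ (sum_necliq (φ := fun d => if Admissible c.1 d then mobius f d else 0)
      (by simp [h0]))
    exact Finset.sum_filter _ _
  have h3 := sum_mobius_filter f (p := fun b => ∃ a ∈ c.1.1, ¬ I.Adj a b) (q := Admissible c.1)
    (r := fun e => ∀ b ∈ e.1, ∀ a ∈ c.1.1, I.Adj a b) (fun _ => Iff.rfl) fun e => by push Not; rfl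
  rw [h2, ← Finset.sum_filter, mobius_eq_mul_sum hf]
  exact congrArg (f c.1.trace * ·) h3.symm

lemma sum_mobius_necliq {f : TraceMonoid I → ℝ} (hf : IsMobiusValuation f) :
    ∑ c : NECliq I, mobius f c.1 = 1 := by
  rw [sum_necliq hf.2.1, sum_mobius, hf.1.map_one]

/-! ### The transition matrix -/

omit [Finite A] in
lemma admissible_of_subset {c d : Clique I} (h : d.1 ⊆ c.1) : Admissible c d :=
  fun b hb => ⟨b, h hb, I.loopless.irrefl b⟩

lemma normalization_pos {h : Clique I → ℝ} (hpos : ∀ c : NECliq I, 0 < h c.1) (c : NECliq I) :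
    0 < normalization h c := by
  classical
  exact Finset.sum_pos (fun d _ => hpos d)
    ⟨c, Finset.mem_filter.2 ⟨Finset.mem_univ _, admissible_of_subset subset_rfl⟩⟩

lemma transitionMatrix_of_admissible {h : Clique I → ℝ} {c d : NECliq I}
    (hcd : Admissible c.1 d.1) : transitionMatrix h c d = h d.1 / normalization h c :=
  if_pos hcd

lemma transitionMatrix_of_not_admissible {h : Clique I → ℝ} {c d : NECliq I}
    (hcd : ¬ Admissible c.1 d.1) : transitionMatrix h c d = 0 :=
  if_neg hcd

lemma transitionMatrix_pos {h : Clique I → ℝ} (hpos : ∀ c : NECliq I, 0 < h c.1) {c d : NECliq I}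
    (hcd : Admissible c.1 d.1) : 0 < transitionMatrix h c d := by
  rw [transitionMatrix_of_admissible hcd]
  exact div_pos (hpos d) (normalization_pos hpos c)

lemma transitionMatrix_nonneg {h : Clique I → ℝ} (hpos : ∀ c : NECliq I, 0 < h c.1)
    (c d : NECliq I) : 0 ≤ transitionMatrix h c d := by
  by_cases hcd : Admissible c.1 d.1
  · exact (transitionMatrix_pos hpos hcd).le
  · rw [transitionMatrix_of_not_admissible hcd]

lemma transitionMatrix_mem_rowStochastic {h : Clique I → ℝ} (hpos : ∀ c : NECliq I, 0 < h c.1) :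
    transitionMatrix h ∈ Matrix.rowStochastic ℝ (NECliq I) := by
  classical
  refine Matrix.mem_rowStochastic_iff_sum.2 ⟨transitionMatrix_nonneg hpos, fun c => ?_⟩
  simp only [transitionMatrix, Matrix.of_apply]
  rw [← Finset.sum_filter, ← Finset.sum_div]
  exact div_self (normalization_pos hpos c).ne'

lemma isAperiodic_transitionMatrix {h : Clique I → ℝ} (hpos : ∀ c : NECliq I, 0 < h c.1) :
    IsAperiodic (transitionMatrix h) := fun x d hd => by
  refine Nat.dvd_one.1 (hd 1 le_rfl ?_)
  rw [pow_one]
  exact transitionMatrix_pos hpos (admissible_of_subset subset_rfl)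

open Classical in
/-- The clique obtained from `s` by adding the letter `x` and dropping the letters that depend
on `x`. -/
noncomputable def replaceBy (s : Clique I) (x : A) : NECliq I :=
  ⟨⟨insert x (s.1.filter (I.Adj x)), by
    rw [Finset.coe_insert, SimpleGraph.isClique_insert]
    exact ⟨s.2.subset (by exact_mod_cast Finset.filter_subset _ _),
      fun b hb _ => (Finset.mem_filter.1 hb).2⟩⟩, Finset.insert_nonempty _ _⟩

omit [Finite A] in
lemma mem_replaceBy {s : Clique I} {x b : A} :
    b ∈ (replaceBy s x).1.1 ↔ b = x ∨ (b ∈ s.1 ∧ I.Adj x b) := by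
  classical
  exact Finset.mem_insert.trans (or_congr Iff.rfl Finset.mem_filter)

omit [Finite A] in
/-- While a letter `x` moves along an edge of the dependence graph, a letter of `s` may be dropped
and come back: it is then dependent on the previous position of `x`. -/
lemma admissible_replaceBy (s : Clique I) {x y : A} (h : ¬ I.Adj x y) :
    Admissible (replaceBy s x).1 (replaceBy s y).1 := by
  intro b hb
  rcases mem_replaceBy.1 hb with rfl | ⟨hbs, -⟩
  · exact ⟨x, mem_replaceBy.2 (.inl rfl), h⟩
  · by_cases hxb : I.Adj x b
    · exact ⟨b, mem_replaceBy.2 (.inr ⟨hbs, hxb⟩), I.loopless.irrefl b⟩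
    · exact ⟨x, mem_replaceBy.2 (.inl rfl), hxb⟩

omit [Finite A] in
lemma reachable_replaceBy (s : Clique I) {x y : A} (p : Iᶜ.Walk x y) :
    Relation.ReflTransGen (fun c d : NECliq I => Admissible c.1 d.1)
      (replaceBy s x) (replaceBy s y) := by
  induction p with
  | nil => exact .refl
  | cons h _ ih => exact .head (admissible_replaceBy s ((SimpleGraph.compl_adj I _ _).1 h).2) ih

omit [Finite A] in
/-- Any two cliques are joined by a path. The target is built up letter by letter: a letter of the
current clique moves to the next letter of the target along a path in the dependence graph, the
other letters being kept as in `replaceBy`. -/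
lemma reachable_of_preconnected (hI : Iᶜ.Preconnected) (c d : NECliq I) :
    Relation.ReflTransGen (fun c d : NECliq I => Admissible c.1 d.1) c d := by
  classical
  obtain ⟨s, hs⟩ := d
  induction s using Clique.induction with
  | empty => exact absurd hs (by simp [Clique.empty])
  | insert a s h ha hadj ih =>
    have htarget : replaceBy s a = ⟨⟨insert a s.1, h⟩, hs⟩ := by
      refine Subtype.ext (Subtype.ext (Finset.ext fun b => ?_))
      refine mem_replaceBy.trans ?_
      change _ ↔ b ∈ insert a s.1
      rw [Finset.mem_insert]
      exact or_congr Iff.rfl (and_iff_left_of_imp (hadj b))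
    rw [← htarget]
    rcases s.1.eq_empty_or_nonempty with he | hne
    · obtain ⟨x, hx⟩ := c.2
      obtain ⟨p⟩ := hI x a
      refine .head (admissible_of_subset fun b hb => ?_) (reachable_replaceBy s p)
      rcases mem_replaceBy.1 hb with rfl | h
      · exact hx
      · exact absurd h.1 (by simp [he])
    · obtain ⟨x, hx⟩ := hne
      obtain ⟨p⟩ := hI x a
      refine (ih ⟨x, hx⟩).trans (.head (admissible_of_subset fun b hb => ?_)
        (reachable_replaceBy s p))
      rcases mem_replaceBy.1 hb with rfl | h
      · exact hx
      · exact h.1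

lemma isIrreducible_transitionMatrix (hI : Iᶜ.Preconnected) {h : Clique I → ℝ}
    (hpos : ∀ c : NECliq I, 0 < h c.1) : (transitionMatrix h).IsIrreducible := by
  have hnn := transitionMatrix_nonneg hpos
  rw [Matrix.isIrreducible_iff_exists_pow_pos hnn]
  intro c d
  induction reachable_of_preconnected hI c d with
  | refl =>
    refine ⟨1, one_pos, ?_⟩
    rw [pow_one]
    exact transitionMatrix_pos hpos (admissible_of_subset subset_rfl)
  | @tail e d _ hed ih =>
    obtain ⟨k, hk, hpow⟩ := ih
    refine ⟨k + 1, k.succ_pos, ?_⟩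
    rw [pow_succ, Matrix.mul_apply]
    exact Finset.sum_pos'
      (fun x _ => mul_nonneg (Matrix.pow_apply_nonneg hnn k c x) (hnn x d))
      ⟨e, Finset.mem_univ _, mul_pos hpow (transitionMatrix_pos hpos hed)⟩

end Mobius

/-! ### Markov chains on a finite set -/

section MarkovChain

lemma cond_real_apply {S : Type*} [MeasurableSpace S] {s : Set S} (hs : MeasurableSet s)
    (μ : Measure S) (t : Set S) : (μ[|s]).real t = (μ.real s)⁻¹ * μ.real (s ∩ t) := by
  rw [measureReal_def, cond_apply hs, ENNReal.toReal_mul, ENNReal.toReal_inv]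
  rfl

lemma setOf_forall_le_succ {S E : Type*} (X : ℕ → S → E) (x : ℕ → E) (n : ℕ) :
    {s | ∀ i ≤ n + 1, X i s = x i} =
      {s | ∀ i ≤ n, X i s = x i} ∩ {s | X (n + 1) s = x (n + 1)} := by
  ext s
  exact ⟨fun h => ⟨fun i hi => h i (by omega), h _ le_rfl⟩, fun h i hi => by
    rcases hi.lt_or_eq with hi | rfl
    · exact h.1 i (by omega)
    · exact h.2⟩

lemma measurableSet_forall_le {S E : Type*} [MeasurableSpace S] [MeasurableSpace E]
    [MeasurableSingletonClass E] {X : ℕ → S → E} (hX : ∀ n, Measurable (X n)) (x : ℕ → E) (n : ℕ) :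
    MeasurableSet {s | ∀ i ≤ n, X i s = x i} := by
  have : {s | ∀ i ≤ n, X i s = x i} = ⋂ i ≤ n, X i ⁻¹' {x i} := by ext; simp
  rw [this]
  exact .biInter (Set.to_countable _) fun i _ => hX i (measurableSet_singleton _)

variable {S E : Type*} [MeasurableSpace S] [MeasurableSpace E] [Fintype E] [DecidableEq E]
  [MeasurableSingletonClass E]

/-- The finite-dimensional laws of a Markov chain. -/
lemma IsMarkovChain.real_path {μ : Measure S} {X : ℕ → S → E} {ν : E → ℝ} {P : Matrix E E ℝ}
    (h : IsMarkovChain μ X ν P) (x : ℕ → E) (n : ℕ) :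
    μ.real {s | ∀ i ≤ n, X i s = x i} = ν (x 0) * ∏ i ∈ Finset.range n, P (x i) (x (i + 1)) := by
  have := h.isProbabilityMeasure
  induction n with
  | zero => simp [h.initial]
  | succ n ih =>
    rw [Finset.prod_range_succ, ← mul_assoc, ← ih, setOf_forall_le_succ]
    by_cases h0 : μ {s | ∀ i ≤ n, X i s = x i} = 0
    · rw [measureReal_def, measureReal_def, h0, measure_mono_null Set.inter_subset_left h0]
      simp
    · rw [← h.markov n x (x (n + 1)) h0, cond_real_apply (measurableSet_forall_le h.measurable x n) μ,
        ← mul_assoc,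
        mul_inv_cancel₀ ((measureReal_ne_zero_iff (measure_ne_top _ _)).2 h0), one_mul]

/-- A sequence with the finite-dimensional laws of a Markov chain is a Markov chain. -/
lemma IsMarkovChain.of_real_path {μ : Measure S} [IsProbabilityMeasure μ] {X : ℕ → S → E}
    {ν : E → ℝ} {P : Matrix E E ℝ} (hX : ∀ n, Measurable (X n)) (hP : P ∈ Matrix.rowStochastic ℝ E)
    (h : ∀ (x : ℕ → E) (n : ℕ), μ.real {s | ∀ i ≤ n, X i s = x i} =
      ν (x 0) * ∏ i ∈ Finset.range n, P (x i) (x (i + 1))) : IsMarkovChain μ X ν P where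
  isProbabilityMeasure := inferInstance
  measurable := hX
  stochastic := hP
  initial x := by simpa using h (fun _ => x) 0
  markov n x y h0 := by
    have h1 := (measureReal_ne_zero_iff (measure_ne_top μ _)).2 h0
    -- the path `x` continued by `y`
    let z : ℕ → E := fun i => if i ≤ n then x i else y
    have hz : ∀ i ≤ n, z i = x i := fun i hi => if_pos hi
    have hz' : z (n + 1) = y := if_neg (by omega)
    have h2 : {s | ∀ i ≤ n, X i s = x i} = {s | ∀ i ≤ n, X i s = z i} := by
      ext s
      exact forall₂_congr fun i hi => by rw [hz i hi]
    rw [cond_real_apply (measurableSet_forall_le hX x n) μ, inv_mul_eq_iff_eq_mul₀ h1, h2, ← hz',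
      ← setOf_forall_le_succ, h, h,
      Finset.prod_range_succ, mul_assoc, hz n le_rfl]

/-- Existence of Markov chains, on the space of sequences of states. -/
lemma exists_measure_isMarkovChain {ν : E → ℝ} (hν : ∀ x, 0 ≤ ν x) (hν1 : ∑ x, ν x = 1)
    {P : Matrix E E ℝ} (hP : P ∈ Matrix.rowStochastic ℝ E) :
    ∃ μ : Measure (ℕ → E), IsMarkovChain μ (fun n x => x n) ν P := by
  classical
  have hP' := Matrix.mem_rowStochastic_iff_sum.1 hP
  -- the law on a finite set with given weights
  let law : (E → ℝ) → Measure E := fun w => ∑ y, ENNReal.ofReal (w y) • Measure.dirac y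
  have law_singleton (w : E → ℝ) (y : E) : law w {y} = ENNReal.ofReal (w y) := by
    simp only [law, Measure.finsetSum_apply, Measure.smul_apply, smul_eq_mul]
    rw [Finset.sum_eq_single y]
    · simp
    · intro z _ hz
      simp [hz]
    · simp
  have law_prob (w : E → ℝ) (hw : ∀ y, 0 ≤ w y) (hw1 : ∑ y, w y = 1) :
      IsProbabilityMeasure (law w) := by
    constructor
    simp only [law, Measure.finsetSum_apply, Measure.smul_apply, smul_eq_mul, measure_univ, mul_one]
    rw [← ENNReal.ofReal_sum_of_nonneg fun y _ => hw y, hw1, ENNReal.ofReal_one]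
  let κ : (n : ℕ) → Kernel (Π _ : Finset.Iic n, E) E := fun n =>
    ⟨fun x => law (P (x ⟨n, Finset.mem_Iic.2 le_rfl⟩)), measurable_of_finite _⟩
  have hκ : ∀ n, IsMarkovKernel (κ n) := fun n =>
    ⟨fun x => law_prob _ (hP'.1 _) (hP'.2 _)⟩
  have hν' := law_prob ν hν hν1
  let μ : Measure (ℕ → E) := Kernel.trajMeasure (X := fun _ => E) (law ν) κ
  have hμ : IsProbabilityMeasure μ := inferInstance
  refine ⟨μ, .of_real_path (fun n => measurable_pi_apply n) hP fun x n => ?_⟩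
  have hset (m : ℕ) : {s : ℕ → E | ∀ i ≤ m, s i = x i} =
        Preorder.frestrictLe (π := fun _ : ℕ => E) m ⁻¹' {fun i : Finset.Iic m => x i} := by
    ext s
    simp only [Set.mem_preimage, Set.mem_singleton_iff, funext_iff, Subtype.forall, Finset.mem_Iic]
    rfl
  induction n with
  | zero =>
    have h : μ.map (Preorder.frestrictLe 0) =
        (law ν).map (MeasurableEquiv.piUnique fun _ : Finset.Iic 0 => E).symm := by
      simp only [μ, Kernel.trajMeasure]
      rw [Measure.map_comp _ _ (by fun_prop), Kernel.traj_map_frestrictLe, Kernel.partialTraj_self,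
        Measure.id_comp]
    have hm : Measurable (Preorder.frestrictLe (π := fun _ : ℕ => E) 0) := by fun_prop
    rw [hset, measureReal_def, ← Measure.map_apply hm (measurableSet_singleton _), h,
      MeasurableEquiv.map_apply]
    have h' : (MeasurableEquiv.piUnique fun _ : Finset.Iic 0 => E).symm ⁻¹'
        {fun i : Finset.Iic 0 => x i} = {x 0} := by
      ext y
      simp only [Set.mem_preimage, Set.mem_singleton_iff, MeasurableEquiv.symm_apply_eq]
      rfl
    rw [h', law_singleton, ENNReal.toReal_ofReal (hν _)]
    simp
  | succ n ih =>
    have h := Kernel.map_frestrictLe_trajMeasure_compProd_eq_map_trajMeasure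
      (X := fun _ => E) (κ := κ) (μ₀ := law ν) (a := n)
    have h' : {s : ℕ → E | ∀ i ≤ n + 1, s i = x i} =
        (fun s : ℕ → E => (Preorder.frestrictLe n s, s (n + 1))) ⁻¹'
          ({fun i : Finset.Iic n => x i} ×ˢ {x (n + 1)}) := by
      rw [setOf_forall_le_succ (fun i (s : ℕ → E) => s i), hset]
      rfl
    have hm : Measurable (Preorder.frestrictLe (π := fun _ : ℕ => E) n) := by fun_prop
    rw [Finset.prod_range_succ, ← mul_assoc, ← ih, h', hset, measureReal_def,
      ← Measure.map_apply (hm.prodMk (measurable_pi_apply _))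
        ((measurableSet_singleton _).prod (measurableSet_singleton _))]
    change ((Kernel.trajMeasure (X := fun _ => E) (law ν) κ).map _ _).toReal = _
    rw [← h, Measure.compProd_apply_prod (measurableSet_singleton _) (measurableSet_singleton _),
      lintegral_singleton, Measure.map_apply hm (measurableSet_singleton _), ENNReal.toReal_mul,
      mul_comm]
    congr 1
    change (law (P (x n)) {x (n + 1)}).toReal = _
    rw [law_singleton, ENNReal.toReal_ofReal (hP'.1 _ _)]

end MarkovChain

section Bernoulli

variable {A : Type*} {I : SimpleGraph A}

/-! ### The law of the cliques under a Bernoulli measure -/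

lemma IsValuation.map_cliqueProd {f : TraceMonoid I → ℝ} (hf : IsValuation f) (c : ℕ → Clique I)
    (n : ℕ) : f (cliqueProd c n) = ∏ i ∈ Finset.range n, f (c i).trace := by
  induction n with
  | zero => simpa [cliqueProd_zero] using hf.map_one
  | succ n ih => rw [cliqueProd_succ, hf.2, ih, Finset.prod_range_succ]

lemma isValuation_inducedVal {μ : Measure (Boundary I)} (hμ : IsBernoulli μ) :
    IsValuation (inducedVal μ) := by
  have := hμ.1
  refine ⟨fun u => ENNReal.toReal_pos (hμ.2.1 u).ne' (measure_ne_top _ _), fun u v => ?_⟩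
  simp only [inducedVal, measureReal_def]
  rw [hμ.2.2, ENNReal.toReal_mul]

variable [Finite A]

open Classical in
lemma mul_mobius {f : TraceMonoid I → ℝ} (hf : IsValuation f) (u : TraceMonoid I) (c : Clique I) :
    f u * mobius f c = ∑ d : Clique I with c.1 ⊆ d.1,
      (-1) ^ (d.1.card - c.1.card) * f (u * d.trace) := by
  rw [mobius_eq, Finset.mul_sum]
  exact Finset.sum_congr rfl fun d _ => by rw [hf.2]; ring

/-- The integral of the identity `sum_indicator_mem` against a Bernoulli measure. -/
lemma real_hasNext {μ : Measure (Boundary I)} (hμ : IsBernoulli μ) (u : TraceMonoid I)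
    (c : Clique I) : μ.real {ξ | HasNext (idealOf ξ.1) u c} =
      inducedVal μ u * mobius (inducedVal μ) c := by
  classical
  have := hμ.1
  have h1 {s : Set (Boundary I)} (hs : MeasurableSet s) :
      ∫ ξ, (if ξ ∈ s then (1 : ℝ) else 0) ∂μ = μ.real s := by
    rw [← integral_indicator_one hs]
    rfl
  have h2 {s : Set (Boundary I)} (hs : MeasurableSet s) :
      Integrable (fun ξ => if ξ ∈ s then (1 : ℝ) else 0) μ :=
    (integrable_const (1 : ℝ)).indicator hs
  rw [mul_mobius (isValuation_inducedVal hμ), ← h1 (measurableSet_hasNext u c)]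
  have h3 (ξ : Boundary I) := sum_indicator_mem (idealOf ξ.1) u c
  refine (integral_congr_ae (.of_forall fun ξ => (h3 ξ).symm)).trans ?_
  refine (integral_finsetSum _ fun d _ =>
    (h2 (measurableSet_cyl (u * d.trace))).const_mul _).trans ?_
  refine Finset.sum_congr rfl fun d _ => ?_
  refine (integral_const_mul _ _).trans ?_
  exact congrArg _ (h1 (measurableSet_cyl (u * d.trace)))

lemma mobius_empty_inducedVal {μ : Measure (Boundary I)} (hμ : IsBernoulli μ) :
    mobius (inducedVal μ) (Clique.empty I) = 0 := by
  have h := real_hasNext hμ 1 (Clique.empty I)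
  have h' : {ξ : Boundary I | HasNext (idealOf ξ.1) 1 (Clique.empty I)} = ∅ := by
    refine Set.eq_empty_iff_forall_notMem.2 fun ξ hξ => ?_
    obtain ⟨a, ha⟩ := cfSeq_nonempty ξ 0
    exact absurd ((hξ.2 a).1 (mem_cfSeq.1 ha)) (by simp [Clique.empty])
  rw [h', measureReal_empty] at h
  exact (mul_eq_zero.1 h.symm).resolve_left ((isValuation_inducedVal hμ).1 1).ne'

lemma real_toPath_pathCyl {μ : Measure (Boundary I)} (hμ : IsBernoulli μ) {n : ℕ}
    {c : ℕ → NECliq I} (hc : ∀ i < n, Admissible (c i).1 (c (i + 1)).1) :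
    μ.real {ξ | ∀ i ≤ n, coord i (toPath ξ) = c i} =
      (∏ i ∈ Finset.range n, inducedVal μ (c i).trace) * mobius (inducedVal μ) (c n).1 := by
  have h : {ξ : Boundary I | ∀ i ≤ n, coord i (toPath ξ) = c i} =
      {ξ | HasNext (idealOf ξ.1) (cliqueProd (fun i => (c i).1) n) (c n).1} :=
    Set.ext fun ξ => toPath_mem_pathCyl hc
  rw [h, real_hasNext hμ, (isValuation_inducedVal hμ).map_cliqueProd]
  rfl

/-! ### Traces that determine the first clique -/

omit [Finite A] in
/-- A word whose consecutive letters are dependent has only one letter as left divisor. -/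
lemma letter_le_word_of_isChain {x : A} {w : List A}
    (hw : List.IsChain (fun a b => ¬ I.Adj a b) (x :: w)) {a : A}
    (h : letter I a ≤ ((x :: w).map (letter I)).prod) : a = x := by
  induction w generalizing x with
  | nil =>
    rw [List.map_cons, List.prod_cons, letter_le_letter_mul] at h
    exact h.resolve_right fun h => not_letter_le_one a h.2
  | cons y w ih =>
    rw [List.map_cons, List.prod_cons, letter_le_letter_mul] at h
    refine h.resolve_right fun ⟨h1, h2⟩ => ?_
    obtain rfl := ih hw.tail h2
    exact (List.isChain_cons_cons.1 hw).1 h1.symm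

/-- Since the dependence graph is connected, a walk in it visits all letters. -/
lemma exists_isChain_mem (hI : Iᶜ.Preconnected) (x : A) :
    ∃ w : List A, List.IsChain (fun a b => ¬ I.Adj a b) (x :: w) ∧ ∀ a, a ∈ x :: w := by
  classical
  have := Fintype.ofFinite A
  obtain ⟨y, p, hp⟩ : ∃ (y : A) (p : Iᶜ.Walk x y), ∀ a ∈ (Finset.univ : Finset A),
      a ∈ p.support := by
    induction (Finset.univ : Finset A) using Finset.induction_on with
    | empty => exact ⟨x, .nil, by simp⟩
    | insert b s _ ih =>
      obtain ⟨y, p, hp⟩ := ih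
      obtain ⟨q⟩ := hI y b
      refine ⟨b, p.append q, fun a ha => ?_⟩
      rw [SimpleGraph.Walk.mem_support_append_iff]
      rcases Finset.mem_insert.1 ha with rfl | ha
      · exact .inr q.end_mem_support
      · exact .inl (hp a ha)
  refine ⟨p.support.tail, ?_, fun a => ?_⟩
  · rw [p.cons_tail_support]
    exact p.isChain_adj_support.imp fun a b h => ((SimpleGraph.compl_adj I _ _).1 h).2
  · rw [p.cons_tail_support]
    exact hp a (Finset.mem_univ a)

/-- For each non-empty clique `c` there is a trace all of whose infinite multiples have `c` as
their first clique: follow `c` by a walk that starts in `c` and visits all letters. -/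
lemma exists_cyl_subset (hI : Iᶜ.Preconnected) (c : NECliq I) :
    ∃ u : TraceMonoid I, ∀ ξ ∈ cyl u, coord 0 (toPath ξ) = c := by
  obtain ⟨x, hx⟩ := c.2
  obtain ⟨w, hw, hmem⟩ := exists_isChain_mem hI x
  refine ⟨c.1.trace * ((x :: w).map (letter I)).prod, fun ξ hξ => ?_⟩
  refine Subtype.ext (Subtype.ext (Finset.ext fun a => ?_))
  refine (mem_firstClique (D := idealOf ξ.1)).trans ⟨fun ha => ?_, fun ha => ?_⟩
  · obtain ⟨y, -, hay, q, rfl⟩ := (idealOf ξ.1).directed _ ha _ hξ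
    rw [mul_assoc, letter_le_clique_mul] at hay
    refine hay.resolve_right fun ⟨h1, h2⟩ => ?_
    rcases letter_le_word_mul h2 with h3 | h3
    · exact I.loopless.irrefl _ (h1 a (letter_le_word_of_isChain hw h3 ▸ hx))
    · exact I.loopless.irrefl _ (h3 a (hmem a))
  · exact (idealOf ξ.1).lower ((letter_le_clique.2 ha).trans (le_mul_right _ _)) hξ

/-- The induced valuation of a Bernoulli measure is a Möbius valuation. -/
lemma isMobiusValuation_inducedVal (hI : Iᶜ.Preconnected) {μ : Measure (Boundary I)}
    (hμ : IsBernoulli μ) : IsMobiusValuation (inducedVal μ) := by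
  refine ⟨isValuation_inducedVal hμ, mobius_empty_inducedVal hμ, fun c => ?_⟩
  have := hμ.1
  have h := real_toPath_pathCyl hμ (n := 0) (c := fun _ => c) (by simp)
  rw [Finset.prod_range_zero, one_mul] at h
  rw [← h]
  obtain ⟨u, hu⟩ := exists_cyl_subset hI c
  refine ((isValuation_inducedVal hμ).1 u).trans_le (measureReal_mono fun ξ hξ i hi => ?_)
  obtain rfl : i = 0 := by omega
  exact hu ξ hξ

/-! ### The Markov chain of a Möbius valuation -/

/-- The normalizing factors telescope, because `h c / g c = f c`. -/
lemma mobius_mul_prod_transitionMatrix {f : TraceMonoid I → ℝ} (hf : IsMobiusValuation f) {n : ℕ}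
    {c : ℕ → NECliq I} (hc : ∀ i < n, Admissible (c i).1 (c (i + 1)).1) :
    mobius f (c 0).1 * ∏ i ∈ Finset.range n, transitionMatrix (mobius f) (c i) (c (i + 1)) =
      (∏ i ∈ Finset.range n, f (c i).trace) * mobius f (c n).1 := by
  induction n with
  | zero => simp
  | succ n ih =>
    rw [Finset.prod_range_succ, ← mul_assoc, ih fun i hi => hc i (by omega),
      transitionMatrix_of_admissible (hc n (by omega)), Finset.prod_range_succ,
      mobius_eq_mul_normalization hf.1 hf.2.1 (c n)]
    have := (normalization_pos hf.2.2 (c n)).ne'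
    field_simp

lemma prod_transitionMatrix_eq_zero {h : Clique I → ℝ} {n : ℕ} {c : ℕ → NECliq I}
    (hc : ¬ ∀ i < n, Admissible (c i).1 (c (i + 1)).1) :
    ∏ i ∈ Finset.range n, transitionMatrix h (c i) (c (i + 1)) = 0 := by
  push Not at hc
  obtain ⟨i, hi, h⟩ := hc
  exact Finset.prod_eq_zero (Finset.mem_range.2 hi) (transitionMatrix_of_not_admissible h)

lemma isMarkovChain_toPath (hI : Iᶜ.Preconnected) {μ : Measure (Boundary I)}
    (hμ : IsBernoulli μ) : IsMarkovChain μ (fun k ξ => coord k (toPath ξ))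
      (fun c => mobius (inducedVal μ) c.1) (transitionMatrix (mobius (inducedVal μ))) := by
  have := hμ.1
  have hf := isMobiusValuation_inducedVal hI hμ
  refine .of_real_path (fun n => (measurable_coord n).comp measurable_toPath)
    (transitionMatrix_mem_rowStochastic hf.2.2) fun x n => ?_
  by_cases hx : ∀ i < n, Admissible (x i).1 (x (i + 1)).1
  · rw [real_toPath_pathCyl hμ hx, mobius_mul_prod_transitionMatrix hf hx]
  · rw [prod_transitionMatrix_eq_zero hx, mul_zero]
    change μ.real (toPath ⁻¹' pathCyl x n) = 0
    rw [pathCyl_eq_empty hx, Set.preimage_empty, measureReal_empty]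

lemma isMarkovChain_coord_unique {ν : NECliq I → ℝ} {P : Matrix (NECliq I) (NECliq I) ℝ}
    {Q R : Measure (Path I)} (hQ : IsMarkovChain Q coord ν P) (hR : IsMarkovChain R coord ν P) :
    Q = R := by
  have := hQ.isProbabilityMeasure
  have := hR.isProbabilityMeasure
  refine ext_of_generate_finite _ measurableSpace_path_eq ?_ ?_ (by simp)
  · rintro _ ⟨x, n, rfl⟩ _ ⟨y, m, rfl⟩ ⟨ω, hx, hy⟩
    refine ⟨fun i => coord i ω, max n m, ?_⟩
    ext ω'
    constructor
    · rintro ⟨h1, h2⟩ i hi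
      rcases le_max_iff.1 hi with hi | hi
      · exact (h1 i hi).trans (hx i hi).symm
      · exact (h2 i hi).trans (hy i hi).symm
    · exact fun h => ⟨fun i hi => (h i (hi.trans (le_max_left _ _))).trans (hx i hi),
        fun i hi => (h i (hi.trans (le_max_right _ _))).trans (hy i hi)⟩
  · rintro _ ⟨x, n, rfl⟩
    refine (ENNReal.toReal_eq_toReal_iff' (measure_ne_top _ _) (measure_ne_top _ _)).1 ?_
    exact (hQ.real_path x n).trans (hR.real_path x n).symm

lemma exists_isMarkovChain_coord {f : TraceMonoid I → ℝ} (hf : IsMobiusValuation f) :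
    ∃ Q : Measure (Path I),
      IsMarkovChain Q coord (fun c => mobius f c.1) (transitionMatrix (mobius f)) := by
  have hP := transitionMatrix_mem_rowStochastic hf.2.2
  have hsing : MeasurableSingletonClass (NECliq I) := ⟨fun _ => trivial⟩
  obtain ⟨μ, hμ⟩ := exists_measure_isMarkovChain (fun c => (hf.2.2 c).le) (sum_mobius_necliq hf) hP
  have := hμ.isProbabilityMeasure
  let adm : Set (ℕ → NECliq I) := {x | ∀ k, Admissible (x k).1 (x (k + 1)).1}
  have hadm : MeasurableSet adm := by
    have : adm = ⋂ k, (fun x : ℕ → NECliq I => (x k, x (k + 1))) ⁻¹'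
        {p | Admissible p.1.1 p.2.1} := by
      ext x
      simp [adm]
    rw [this]
    exact .iInter fun k => ((measurable_pi_apply k).prodMk (measurable_pi_apply (k + 1)))
      (Set.toFinite _).measurableSet
  -- the chain almost surely makes admissible steps only
  have hnull : μ admᶜ = 0 := by
    have hsub : admᶜ ⊆ ⋃ (k : ℕ) (x : Fin (k + 2) → NECliq I)
        (_ : ¬ ∀ i < k + 1,
          Admissible (x (Fin.ofNat (k + 2) i)).1 (x (Fin.ofNat (k + 2) (i + 1))).1),
        {s : ℕ → NECliq I | ∀ i ≤ k + 1, s i = x (Fin.ofNat (k + 2) i)} := by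
      intro s hs
      obtain ⟨k, hk⟩ := not_forall.1 hs
      have hval (i : ℕ) (hi : i ≤ k + 1) : (Fin.ofNat (k + 2) i : ℕ) = i :=
        Nat.mod_eq_of_lt (by omega)
      refine Set.mem_iUnion.2 ⟨k, Set.mem_iUnion.2 ⟨fun i => s i, Set.mem_iUnion.2 ⟨fun h => hk ?_,
        fun i hi => congrArg s (hval i hi).symm⟩⟩⟩
      have h1 := h k (by omega)
      beta_reduce at h1
      rwa [hval k (by omega), hval (k + 1) le_rfl] at h1
    refine measure_mono_null hsub (measure_iUnion_null fun k => measure_iUnion_null fun x =>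
      measure_iUnion_null fun hx => ?_)
    rw [← measureReal_eq_zero_iff, hμ.real_path (fun i => x (Fin.ofNat (k + 2) i)) (k + 1),
      prod_transitionMatrix_eq_zero hx, mul_zero]
  have hemb : MeasurableEmbedding (fun ω : Path I => ω.1) := MeasurableEmbedding.subtype_coe hadm
  have hrange : Set.range (fun ω : Path I => ω.1) = adm := Subtype.range_coe
  have hcomap (s : Set (ℕ → NECliq I)) :
      μ.comap (fun ω : Path I => ω.1) ((fun ω : Path I => ω.1) ⁻¹' s) = μ s := by
    rw [hemb.comap_preimage, hrange]
    exact measure_inter_conull hnull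
  have : IsProbabilityMeasure (μ.comap (fun ω : Path I => ω.1)) :=
    ⟨by simpa using hcomap Set.univ⟩
  refine ⟨μ.comap (fun ω : Path I => ω.1), .of_real_path measurable_coord hP fun x n => ?_⟩
  rw [← hμ.real_path x n]
  exact congrArg ENNReal.toReal (hcomap {s | ∀ i ≤ n, s i = x i})

end Bernoulli

section Law

variable {A : Type*} {I : SimpleGraph A}

/-! ### Linear relations between cylinders of finite traces -/

open Classical in
/-- The indicator functions of the sets `{w | v ≤ w}` of traces are linearly independent: evaluate
a linear relation at a shortest trace among those with non-zero coefficient. -/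
lemma eq_zero_of_sum_indicator_le {x : TraceMonoid I →₀ ℝ}
    (h : ∀ w, Finsupp.linearCombination ℝ (fun v => if v ≤ w then (1 : ℝ) else 0) x = 0) :
    x = 0 := by
  by_contra hx
  obtain ⟨w, hw, hmin⟩ := x.support.exists_min_image length (Finsupp.support_nonempty_iff.2 hx)
  refine Finsupp.mem_support_iff.1 hw ?_
  have h1 := h w
  rw [Finsupp.linearCombination_apply, Finsupp.sum, Finset.sum_eq_single w] at h1
  · simpa using h1
  · intro v hv hvw
    have h2 : ¬ v ≤ w := by
      rintro ⟨t, rfl⟩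
      have h3 := hmin v hv
      rw [length_mul] at h3
      exact hvw (by rw [eq_one_of_length t (by omega), mul_one])
    simp [h2]
  · exact fun h => absurd hw h

open Classical in
/-- A linear relation between the indicator functions of the sets `{w | v ≤ w}` is satisfied by
every function of `v`. -/
lemma linearCombination_eq_of_indicator_le {x y : TraceMonoid I →₀ ℝ}
    (h : ∀ w, Finsupp.linearCombination ℝ (fun v => if v ≤ w then (1 : ℝ) else 0) x =
      Finsupp.linearCombination ℝ (fun v => if v ≤ w then (1 : ℝ) else 0) y)
    (f : TraceMonoid I → ℝ) :
    Finsupp.linearCombination ℝ f x = Finsupp.linearCombination ℝ f y := by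
  have : x - y = 0 := eq_zero_of_sum_indicator_le fun w => by rw [map_sub, h w, sub_self]
  rw [sub_eq_zero.1 this]

/-- A finite sequence of cliques, continued periodically; only its first `n + 1` terms matter. -/
def extend {n : ℕ} (c : Fin (n + 1) → Clique I) (i : ℕ) : Clique I := c (Fin.ofNat (n + 1) i)

lemma extend_eq_iff {n : ℕ} {c : Fin (n + 1) → Clique I} {d : ℕ → Clique I} :
    (∀ i ≤ n, d i = extend c i) ↔ (fun i : Fin (n + 1) => d i) = c := by
  constructor
  · intro h
    funext i
    rw [h i (by omega), extend]
    congr 1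
    exact Fin.ext (Nat.mod_eq_of_lt i.2)
  · rintro rfl i hi
    exact congrArg d (Nat.mod_eq_of_lt (Nat.lt_succ_of_le hi)).symm

variable [Finite A]

open Classical in
/-- The expansion of a valuation along the Cartier–Foata sequences of length `n + 1`. The
corresponding relation between indicator functions says that a trace `w` is a multiple of `u` if and
only if the product of its first `n + 1` cliques is. -/
lemma IsValuation.eq_sum_cliqueProd {f : TraceMonoid I → ℝ} (hf : IsValuation f)
    {u : TraceMonoid I} {n : ℕ} (hn : length u ≤ n + 1) :
    f u = ∑ c : Fin (n + 1) → Clique I with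
      (∀ i < n, Admissible (extend c i) (extend c (i + 1))) ∧ u ≤ cliqueProd (extend c) (n + 1),
        f (cliqueProd (extend c) n) * mobius f (extend c n) := by
  let S : Finset (Fin (n + 1) → Clique I) := {c |
    (∀ i < n, Admissible (extend c i) (extend c (i + 1))) ∧ u ≤ cliqueProd (extend c) (n + 1)}
  let y : TraceMonoid I →₀ ℝ := ∑ c ∈ S, ∑ d : Clique I with (extend c n).1 ⊆ d.1,
    Finsupp.single (cliqueProd (extend c) n * d.trace) ((-1) ^ (d.1.card - (extend c n).1.card))
  have hy (g : TraceMonoid I → ℝ) : Finsupp.linearCombination ℝ g y =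
      ∑ c ∈ S, ∑ d : Clique I with (extend c n).1 ⊆ d.1,
        (-1) ^ (d.1.card - (extend c n).1.card) * g (cliqueProd (extend c) n * d.trace) := by
    simp only [y, map_sum, Finsupp.linearCombination_single, smul_eq_mul]
  have h := linearCombination_eq_of_indicator_le (x := Finsupp.single u 1) (y := y) ?_ f
  · rw [hy, Finsupp.linearCombination_single, one_smul] at h
    rw [h]
    exact Finset.sum_congr rfl fun c _ => (mul_mobius hf _ _).symm
  · intro w
    let D : Order.Ideal (TraceMonoid I) := Order.Ideal.principal w
    have hD (v : TraceMonoid I) : v ≤ w ↔ v ∈ D := Order.Ideal.mem_principal.symm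
    rw [hy, Finsupp.linearCombination_single, one_smul]
    simp only [hD]
    have h1 : ∀ c ∈ S, ∑ d : Clique I with (extend c n).1 ⊆ d.1,
        (-1 : ℝ) ^ (d.1.card - (extend c n).1.card) *
          (if cliqueProd (extend c) n * d.trace ∈ D then 1 else 0) =
        if (fun i : Fin (n + 1) => cfSeq D i) = c then 1 else 0 := by
      intro c hc
      rw [sum_indicator_mem]
      refine if_congr ?_ rfl rfl
      rw [← cfSeq_eq_iff_hasNext (Finset.mem_filter.1 hc).2.1, extend_eq_iff]
    rw [Finset.sum_congr rfl h1, Finset.sum_ite_eq]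
    refine if_congr ?_ rfl rfl
    have h2 := extend_eq_iff.2 (rfl : (fun i : Fin (n + 1) => cfSeq D i) = _)
    rw [mem_iff_le_cliqueProd_cfSeq hn, cliqueProd_congr fun i hi => h2 i (Nat.le_of_lt_succ hi)]
    refine ⟨fun h => Finset.mem_filter.2 ⟨Finset.mem_univ _, fun i hi => ?_, h⟩,
      fun h => (Finset.mem_filter.1 h).2.2⟩
    rw [← h2 i hi.le, ← h2 (i + 1) hi]
    exact admissible_cfSeq D i

/-! ### The law of the Markov chain on the boundary -/

omit [Finite A] in
lemma nonempty_of_admissible {c : ℕ → Clique I} {n : ℕ}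
    (hc : ∀ i < n, Admissible (c i) (c (i + 1))) (hn : (c n).1.Nonempty) :
    ∀ i ≤ n, (c i).1.Nonempty := by
  intro i hi
  induction hi using Nat.decreasingInduction with
  | self => exact hn
  | of_succ k hk ih =>
    obtain ⟨b, hb⟩ := ih
    obtain ⟨a, ha, -⟩ := hc k hk b hb
    exact ⟨a, ha⟩

/-- The law of the first cliques of the chain, for sequences of possibly empty cliques: both sides
vanish if the last clique is empty. -/
lemma IsMarkovChain.real_cliques {f : TraceMonoid I → ℝ} (hf : IsMobiusValuation f)
    {Q : Measure (Path I)}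
    (hQ : IsMarkovChain Q coord (fun c => mobius f c.1) (transitionMatrix (mobius f)))
    {c : ℕ → Clique I} {n : ℕ} (hc : ∀ i < n, Admissible (c i) (c (i + 1))) :
    Q.real {ω | ∀ i ≤ n, cliques ω i = c i} = f (cliqueProd c n) * mobius f (c n) := by
  rcases (c n).1.eq_empty_or_nonempty with he | hne
  · have h : {ω : Path I | ∀ i ≤ n, cliques ω i = c i} = ∅ := by
      refine Set.eq_empty_iff_forall_notMem.2 fun ω hω => (cliques_nonempty ω n).ne_empty ?_
      rw [hω n le_rfl, he]
    rw [h, measureReal_empty, show c n = Clique.empty I from Subtype.ext he, hf.2.1, mul_zero]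
  · have hne' := nonempty_of_admissible hc hne
    let x (i : ℕ) : NECliq I := if h : (c i).1.Nonempty then ⟨c i, h⟩ else ⟨c n, hne⟩
    have hx (i : ℕ) (hi : i ≤ n) : (x i).1 = c i := congrArg Subtype.val (dif_pos (hne' i hi))
    have hadm : ∀ i < n, Admissible (x i).1 (x (i + 1)).1 := fun i hi => by
      rw [hx i hi.le, hx (i + 1) hi]
      exact hc i hi
    have h : {ω : Path I | ∀ i ≤ n, cliques ω i = c i} = {ω | ∀ i ≤ n, coord i ω = x i} := by
      ext ω
      refine forall₂_congr fun i hi => ?_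
      rw [← hx i hi]
      exact Subtype.ext_iff.symm
    have hsing : MeasurableSingletonClass (NECliq I) := ⟨fun _ => trivial⟩
    rw [h, hQ.real_path x n, mobius_mul_prod_transitionMatrix hf hadm, hf.1.map_cliqueProd,
      hx n le_rfl]
    refine congrArg (· * _) (Finset.prod_congr rfl fun i hi => ?_)
    rw [NECliq.trace, hx i (Finset.mem_range.1 hi).le]

lemma IsMarkovChain.real_map_cyl {f : TraceMonoid I → ℝ} (hf : IsMobiusValuation f)
    {Q : Measure (Path I)}
    (hQ : IsMarkovChain Q coord (fun c => mobius f c.1) (transitionMatrix (mobius f)))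
    (u : TraceMonoid I) : (Q.map ofPath).real (cyl u) = f u := by
  classical
  have := hQ.isProbabilityMeasure
  let n := length u
  let r : Path I → Fin (n + 1) → Clique I := fun ω i => cliques ω i
  let S : Finset (Fin (n + 1) → Clique I) := {c | u ≤ cliqueProd (extend c) (n + 1)}
  have hr (ω : Path I) : ∀ i ≤ n, cliques ω i = extend (r ω) i := extend_eq_iff.2 rfl
  have hfib (c : Fin (n + 1) → Clique I) :
      r ⁻¹' {c} = {ω | ∀ i ≤ n, cliques ω i = extend c i} :=
    Set.ext fun ω => extend_eq_iff.symm
  have hmeas (c : Fin (n + 1) → Clique I) : MeasurableSet (r ⁻¹' {c}) := by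
    have : r ⁻¹' {c} = ⋂ i : Fin (n + 1), coord i ⁻¹' {x | x.1 = c i} := by
      ext ω
      simp only [Set.mem_preimage, Set.mem_singleton_iff, funext_iff, Set.mem_iInter]
      rfl
    rw [this]
    exact .iInter fun i => measurable_coord i trivial
  have hpre : ofPath ⁻¹' cyl u = r ⁻¹' (S : Set (Fin (n + 1) → Clique I)) := by
    ext ω
    refine (mem_iff_le_cliqueProd_cfSeq (D := idealOf (ofPath ω).1) (n := n + 1)
      (Nat.le_succ _)).trans ?_
    rw [cliqueProd_congr (d := extend (r ω)) fun i hi =>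
      (cfSeq_ofPath ω i).trans (hr ω i (Nat.le_of_lt_succ hi))]
    simp [S]
  rw [map_measureReal_apply measurable_ofPath (measurableSet_cyl u), hpre,
    ← sum_measureReal_preimage_singleton S fun c _ => hmeas c,
    hf.1.eq_sum_cliqueProd (Nat.le_succ (length u))]
  rw [← Finset.filter_filter, Finset.filter_comm]
  refine Eq.trans ?_ (Finset.sum_filter _ _).symm
  refine Finset.sum_congr rfl fun c _ => ?_
  rw [hfib]
  split_ifs with hc
  · exact hQ.real_cliques hf hc
  · have h : {ω : Path I | ∀ i ≤ n, cliques ω i = extend c i} = ∅ := by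
      refine Set.eq_empty_iff_forall_notMem.2 fun ω hω => hc fun i hi => ?_
      rw [← hω i hi.le, ← hω (i + 1) hi]
      exact ω.2 i
    rw [h, measureReal_empty]

lemma IsMarkovChain.isBernoulli_map {f : TraceMonoid I → ℝ} (hf : IsMobiusValuation f)
    {Q : Measure (Path I)}
    (hQ : IsMarkovChain Q coord (fun c => mobius f c.1) (transitionMatrix (mobius f))) :
    IsBernoulli (Q.map ofPath) := by
  have := hQ.isProbabilityMeasure
  have hp : IsProbabilityMeasure (Q.map ofPath) :=
    Measure.isProbabilityMeasure_map measurable_ofPath.aemeasurable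
  have h (u : TraceMonoid I) : Q.map ofPath (cyl u) = ENNReal.ofReal (f u) := by
    rw [← hQ.real_map_cyl hf u, ofReal_measureReal]
  refine ⟨hp, fun u => ?_, fun u v => ?_⟩
  · rw [h]
    exact ENNReal.ofReal_pos.2 (hf.1.1 u)
  · rw [h, h, h, hf.1.2, ENNReal.ofReal_mul (hf.1.1 u).le]

end Law

end Trace

theorem theorem2 {A : Type*} [Finite A] (I : SimpleGraph A)
    -- the trace monoid is irreducible: the dependence graph is connected (for the empty alphabet,
    -- which is not excluded, there are no infinite traces and no Möbius valuations)
    (hirr : Iᶜ.Preconnected) :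
    -- the bi-measurable bijection between the boundary and the space of infinite paths,
    -- characterized by `⋁ₖ c₁ ⋯ cₖ = ξ`
    ∃ Ψ : Boundary I ≃ᵐ Path I,
      (∀ ξ : Boundary I, IsLUB (Set.range fun k => embed ((Ψ ξ).partialProd k)) ξ.1) ∧
      -- point 1
      (∀ μ : Measure (Boundary I), IsBernoulli μ →
        (∀ c : NECliq I, 0 < mobius (inducedVal μ) c.1) ∧
        IsMarkovChain μ (fun k ξ => coord k (Ψ ξ)) (fun c => mobius (inducedVal μ) c.1)
          (transitionMatrix (mobius (inducedVal μ))) ∧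
        (transitionMatrix (mobius (inducedVal μ))).IsIrreducible ∧
        IsAperiodic (transitionMatrix (mobius (inducedVal μ))) ∧
        ∀ (n : ℕ) (c : ℕ → NECliq I), (∀ i < n, Admissible (c i).1 (c (i + 1)).1) →
          μ.real {ξ | ∀ i ≤ n, coord i (Ψ ξ) = c i} =
            (∏ i ∈ Finset.range n, inducedVal μ (c i).trace) * mobius (inducedVal μ) (c n).1) ∧
      -- point 2
      (∀ f : TraceMonoid I → ℝ, IsMobiusValuation f →
        (∀ c : NECliq I, 0 ≤ mobius f c.1) ∧ ∑ c : NECliq I, mobius f c.1 = 1 ∧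
        (∃! Q : Measure (Path I),
          IsMarkovChain Q coord (fun c => mobius f c.1) (transitionMatrix (mobius f))) ∧
        ∀ Q : Measure (Path I),
          IsMarkovChain Q coord (fun c => mobius f c.1) (transitionMatrix (mobius f)) →
          IsBernoulli (Q.map Ψ.symm) ∧
          ∀ u : TraceMonoid I, (Q.map Ψ.symm).real (cyl u) = f u) := by
  refine ⟨boundaryEquiv I, isLUB_partialProd_toPath, fun μ hμ => ?_, fun f hf => ?_⟩
  · have hpos := (isMobiusValuation_inducedVal hirr hμ).2.2
    exact ⟨hpos, isMarkovChain_toPath hirr hμ, isIrreducible_transitionMatrix hirr hpos,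
      isAperiodic_transitionMatrix hpos, fun n c hc => real_toPath_pathCyl hμ hc⟩
  · obtain ⟨Q, hQ⟩ := exists_isMarkovChain_coord hf
    exact ⟨fun c => (hf.2.2 c).le, sum_mobius_necliq hf,
      ⟨Q, hQ, fun R hR => isMarkovChain_coord_unique hR hQ⟩,
      fun R hR => ⟨hR.isBernoulli_map hf, hR.real_map_cyl hf⟩⟩
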